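/- Let $\mathbb D$ be the open unit disc, $\mathbb T$ the unit circle with normalized Lebesgue measure, $L^2=L^2(\mathbb T)$, and let $H^2\subset L^2$ be the Hardy space of those $f$ with $\hat f(n)=0$ for all $n<0$. Let $\Theta$ be a nonconstant inner function, that is, a nonconstant bounded analytic function on $\mathbb D$ whose radial limits have modulus one almost everywhere on $\mathbb T$. Let $K_\Theta=H^2\ominus\Theta H^2$ and let $P_\Theta$ be the orthogonal projection of $L^2$ onto $K_\Theta$. For $\varphi\in L^2$ the truncated Toeplitz operator $A_\varphi^\Theta$ is the (possibly unbounded) operator with domain $K_\Theta\cap H^\infty$ given by $A_\varphi^\Theta f=P_\Theta(\varphi f)$. Let $\mathcal T(K_\Theta)$ be the space of all bounded truncated Toeplitz operators (extended by continuity to $K_\Theta$), with the operator norm. For $\lambda\in\mathbb D$ let $$h_\lambda^\Theta(z)=\sqrt{\frac{1-|\lambda|^2}{1-|\Theta(\lambda)|^2}}\;\frac{1-\overline{\Theta(\lambda)}\,\Theta(z)}{1-\bar\lambda z}\in K_\Theta\cap H^\infty$$ be the normalized reproducing kernel of $K_\Theta$, and for a linear operator $T$ whose domain contains $K_\Theta\cap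 H^\infty$ put $\rho_r(T)=\sup_{\lambda\in\mathbb D}\|Th_\lambda^\Theta\|_2\in[0,\infty]$. (1) Assume that for every $\varphi\in L^2$ the inequality $\rho_r(A_\varphi^\Theta)<\infty$ implies that $A_\varphi^\Theta$ is bounded. Then $\mathcal T(K_\Theta)$ is complete with respect to $\rho_r$ (every $\rho_r$-Cauchy sequence in $\mathcal T(K_\Theta)$ converges with respect to $\rho_r$ to an element of $\mathcal T(K_\Theta)$), and $\rho_r$ is equivalent to the operator norm on $\mathcal T(K_\Theta)$: there is $M>0$ such that $\rho_r(A)\le\|A\|\le M\rho_r(A)$ for all $A\in\mathcal T(K_\Theta)$. (2) If $\Theta$ is a singular inner function, that is, a nonconstant inner function without zeros in $\mathbb D$, then the Reproducing Kernel Thesis with kernels only fails for $\Theta$: there is $\varphi\in L^2$ with $\rho_r(A_\varphi^\Theta)<\infty$ such that $A_\varphi^\Theta$ is unbounded. -/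

import Mathlib

open MeasureTheory Filter Topology Set Metric
open scoped ENNReal ComplexConjugate

noncomputable section

namespace TruncToep

instance fact_two_pi_pos : Fact ((0 : ℝ) < 2 * Real.pi) := ⟨Real.two_pi_pos⟩

/-- The unit circle, parametrised as `ℝ / 2πℤ`; the point of the circle with parameter `t` is
`AddCircle.toCircle t = exp (i t)`. -/
abbrev Circ : Type := AddCircle (2 * Real.pi)

/-- Normalised Lebesgue measure on the circle. -/
abbrev m : Measure Circ := AddCircle.haarAddCircle

/-- `L² = L²(𝕋)`. -/
abbrev L2 : Type := Lp ℂ 2 m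

/-- The open unit disc `𝔻`. -/
abbrev Disc : Set ℂ := ball (0 : ℂ) 1

/-- The Hardy space `H²`, as the subspace of those `f ∈ L²` all of whose Fourier coefficients with
negative index vanish. -/
def H2 : Submodule ℂ L2 where
  carrier := {f | ∀ n : ℤ, n < 0 → fourierCoeff (f : Circ → ℂ) n = 0}
  add_mem' := by
    intro f g hf hg n hn
    have h1 := hf n hn
    have h2 := hg n hn
    rw [← fourierBasis_repr] at h1 h2 ⊢
    simp [h1, h2]
  zero_mem' := by
    intro n _
    rw [← fourierBasis_repr]
    simp
  smul_mem' := by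
    intro c f hf n hn
    have h1 := hf n hn
    rw [← fourierBasis_repr] at h1 ⊢
    simp [h1]

/-- An inner function: a bounded analytic function on the unit disc whose radial limits exist and
are of modulus one almost everywhere on the circle. (Only the values on `𝔻` matter.) -/
structure InnerFunction where
  toFun : ℂ → ℂ
  analytic : DifferentiableOn ℂ toFun Disc
  bounded : ∃ M : ℝ, ∀ z ∈ Disc, ‖toFun z‖ ≤ M
  radial : ∀ᵐ t ∂m, ∃ w : ℂ, ‖w‖ = 1 ∧
    Tendsto (fun r : ℝ => toFun ((r : ℂ) * (AddCircle.toCircle t : ℂ))) (𝓝[<] 1) (𝓝 w)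

/-- The function of radial limits of `F` on the circle. -/
def radialLimit (F : ℂ → ℂ) (t : Circ) : ℂ :=
  limUnder (𝓝[<] (1 : ℝ)) (fun r : ℝ => F ((r : ℂ) * (AddCircle.toCircle t : ℂ)))

/-! ### Auxiliary facts on bounded analytic functions and their radial limits -/

/-- `F` is a bounded analytic function on the disc, with radial limits `u` almost everywhere. -/
structure BddBoundary (F : ℂ → ℂ) (u : Circ → ℂ) : Prop where
  diff : DifferentiableOn ℂ F Disc
  bdd : ∃ M : ℝ, ∀ z ∈ Disc, ‖F z‖ ≤ M
  lim : ∀ᵐ t ∂m, Tendsto (fun r : ℝ => F ((r : ℂ) * (AddCircle.toCircle t : ℂ)))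
    (𝓝[<] 1) (𝓝 (u t))

/-- A sequence of radii increasing to one. -/
def rad (n : ℕ) : ℝ := 1 - 1 / ((n : ℝ) + 2)

lemma rad_pos (n : ℕ) : 0 < rad n := by
  have : (1 : ℝ) / ((n : ℝ) + 2) < 1 := by
    rw [div_lt_one (by positivity)]
    have : (0 : ℝ) ≤ n := by positivity
    linarith
  unfold rad; linarith

lemma rad_lt (n : ℕ) : rad n < 1 := by
  have : (0 : ℝ) < 1 / ((n : ℝ) + 2) := by positivity
  unfold rad; linarith

lemma tendsto_rad : Tendsto rad atTop (𝓝[<] 1) := by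
  refine tendsto_nhdsWithin_iff.2 ⟨?_, Eventually.of_forall rad_lt⟩
  have h := tendsto_one_div_add_atTop_nhds_zero_nat (𝕜 := ℝ)
  have h2 := (h.comp (tendsto_add_atTop_nat 1)).const_sub 1
  simp only [sub_zero] at h2
  refine h2.congr fun n => ?_
  simp only [Function.comp, rad]
  push_cast
  ring_nf

lemma mul_mem_disc {r : ℝ} (h0 : 0 ≤ r) (h1 : r < 1) (t : Circ) :
    (r : ℂ) * (AddCircle.toCircle t : ℂ) ∈ Disc := by
  simp [abs_of_nonneg h0, h1, Circle.norm_coe]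

lemma BddBoundary.continuous_rad {F u} (h : BddBoundary F u) (n : ℕ) :
    Continuous (fun t : Circ => F ((rad n : ℂ) * (AddCircle.toCircle t : ℂ))) := by
  refine h.diff.continuousOn.comp_continuous ?_ fun t =>
    mul_mem_disc (rad_pos n).le (rad_lt n) t
  have := AddCircle.continuous_toCircle (T := 2 * Real.pi)
  fun_prop

lemma BddBoundary.lim_seq {F u} (h : BddBoundary F u) :
    ∀ᵐ t ∂m, Tendsto (fun n => F ((rad n : ℂ) * (AddCircle.toCircle t : ℂ))) atTop (𝓝 (u t)) := by
  filter_upwards [h.lim] with t ht using ht.comp tendsto_rad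

lemma BddBoundary.aesm {F u} (h : BddBoundary F u) : AEStronglyMeasurable u m :=
  aestronglyMeasurable_of_tendsto_ae atTop
    (fun n => (h.continuous_rad n).aestronglyMeasurable) h.lim_seq

lemma BddBoundary.memLp {F u} (h : BddBoundary F u) (p : ℝ≥0∞) : MemLp u p m := by
  obtain ⟨M, hM⟩ := h.bdd
  refine MemLp.of_bound h.aesm M ?_
  filter_upwards [h.lim_seq] with t ht
  exact le_of_tendsto ht.norm (Eventually.of_forall fun n =>
    hM _ (mul_mem_disc (rad_pos n).le (rad_lt n) t))

lemma BddBoundary.mul {F G u v} (h : BddBoundary F u) (k : BddBoundary G v) :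
    BddBoundary (fun z => F z * G z) (fun t => u t * v t) where
  diff := h.diff.mul k.diff
  bdd := by
    obtain ⟨M, hM⟩ := h.bdd
    obtain ⟨N, hN⟩ := k.bdd
    refine ⟨M * N, fun z hz => ?_⟩
    rw [norm_mul]
    exact mul_le_mul (hM z hz) (hN z hz) (norm_nonneg _) ((norm_nonneg _).trans (hM z hz))
  lim := by
    filter_upwards [h.lim, k.lim] with t h1 h2 using h1.mul h2

/-- A function that is continuous on the closed disc and analytic inside is its own boundary
function. -/
lemma BddBoundary.of_continuousOn {F : ℂ → ℂ} (hd : DifferentiableOn ℂ F Disc)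
    (hc : ContinuousOn F (closedBall 0 1)) :
    BddBoundary F (fun t => F (AddCircle.toCircle t : ℂ)) where
  diff := hd
  bdd := by
    obtain ⟨M, hM⟩ := (isCompact_closedBall (0 : ℂ) 1).exists_bound_of_continuousOn hc
    exact ⟨M, fun z hz => hM z (ball_subset_closedBall hz)⟩
  lim := by
    refine Eventually.of_forall fun t => ?_
    have h1 : ContinuousWithinAt F (closedBall 0 1) (AddCircle.toCircle t : ℂ) :=
      hc _ (by simp [Circle.norm_coe])
    refine h1.tendsto.comp (tendsto_nhdsWithin_iff.2 ⟨?_, ?_⟩)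
    · have : Continuous (fun r : ℝ => (r : ℂ) * (AddCircle.toCircle t : ℂ)) := by fun_prop
      have h2 := this.tendsto 1
      simp only [Complex.ofReal_one, one_mul] at h2
      exact h2.mono_left nhdsWithin_le_nhds
    · have : Ioo (0 : ℝ) 1 ∈ 𝓝[<] (1 : ℝ) := Ioo_mem_nhdsLT one_pos
      filter_upwards [this] with r hr
      exact ball_subset_closedBall (mul_mem_disc hr.1.le hr.2 t)

lemma integral_rad (F : ℂ → ℂ) (r : ℝ) :
    ∫ t, F ((r : ℂ) * (AddCircle.toCircle t : ℂ)) ∂m = Real.circleAverage F 0 r := by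
  rw [AddCircle.integral_haarAddCircle, Real.circleAverage_def,
    ← AddCircle.intervalIntegral_preimage (2 * Real.pi) 0, zero_add]
  congr 1
  refine intervalIntegral.integral_congr fun x _ => ?_
  simp [AddCircle.toCircle_apply_mk, circleMap]

lemma BddBoundary.integral {F u} (h : BddBoundary F u) : ∫ t, u t ∂m = F 0 := by
  obtain ⟨M, hM⟩ := h.bdd
  have key : Tendsto (fun n => ∫ t, F ((rad n : ℂ) * (AddCircle.toCircle t : ℂ)) ∂m) atTop
      (𝓝 (∫ t, u t ∂m)) := by
    refine tendsto_integral_of_dominated_convergence (fun _ => M)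
      (fun n => (h.continuous_rad n).aestronglyMeasurable) (integrable_const _)
      (fun n => Eventually.of_forall fun t =>
        hM _ (mul_mem_disc (rad_pos n).le (rad_lt n) t)) h.lim_seq
  have hc : ∀ n, ∫ t, F ((rad n : ℂ) * (AddCircle.toCircle t : ℂ)) ∂m = F 0 := by
    intro n
    rw [integral_rad]
    have hs : closedBall (0 : ℂ) |rad n| ⊆ Disc := by
      rw [abs_of_pos (rad_pos n)]
      exact closedBall_subset_ball (rad_lt n)
    refine circleAverage_of_differentiable_on_off_countable countable_empty
      (h.diff.continuousOn.mono hs) fun z hz => ?_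
    exact h.diff.differentiableAt (isOpen_ball.mem_nhds (hs (ball_subset_closedBall hz.1)))
  simp only [hc] at key
  exact tendsto_nhds_unique key tendsto_const_nhds |>.symm ▸ rfl

lemma BddBoundary.monomial (n : ℕ) :
    BddBoundary (fun z => z ^ n) (fun t => fourier (n : ℤ) t) := by
  have := BddBoundary.of_continuousOn (F := fun z => z ^ n) (by fun_prop) (by fun_prop)
  convert this using 2 with t
  simp [fourier_apply, AddCircle.toCircle_nsmul]

lemma BddBoundary.coeff_neg {F u} (h : BddBoundary F u) {n : ℤ} (hn : n < 0) :
    fourierCoeff u n = 0 := by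
  obtain ⟨k, hk⟩ := Int.eq_ofNat_of_zero_le (show 0 ≤ -n by lia)
  have h1 := ((BddBoundary.monomial k).mul h).integral
  have hk0 : k ≠ 0 := by lia
  simp only [ne_eq, hk0, not_false_eq_true, zero_pow, zero_mul] at h1
  rw [fourierCoeff, hk]
  simpa only [smul_eq_mul] using h1

lemma BddBoundary.toLp_mem_H2 {F u} (h : BddBoundary F u) : (h.memLp 2).toLp u ∈ H2 := by
  intro n hn
  rw [fourierCoeff_congr_ae (h.memLp 2).coeFn_toLp]
  exact h.coeff_neg hn

/-- If `G` is bounded analytic and `g ∈ H²`, then `z G g` has mean value zero. -/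
lemma BddBoundary.integral_mul_H2 {G v} (h : BddBoundary G v) {g : L2} (hg : g ∈ H2) :
    ∫ t, (fourier 1 t * v t) * g t ∂m = 0 := by
  have hb : BddBoundary (fun z => z ^ 1 * G z) (fun t => fourier ((1 : ℕ) : ℤ) t * v t) :=
    (BddBoundary.monomial 1).mul h
  simp only [Nat.cast_one] at hb
  have hcm : MemLp (fun t => conj (fourier 1 t * v t)) 2 m := (hb.memLp 2).star
  set x : L2 := hcm.toLp _ with hx
  have hxg : inner ℂ x g = ∫ t, (fourier 1 t * v t) * g t ∂m := by
    rw [L2.inner_def]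
    refine integral_congr_ae ?_
    filter_upwards [hcm.coeFn_toLp] with t ht
    rw [hx, ht, RCLike.inner_apply']
    simp
  rw [← hxg, ← fourierBasis.tsum_inner_mul_inner x g]
  refine (tsum_congr fun i => ?_).trans tsum_zero
  rw [← HilbertBasis.repr_apply_apply, fourierBasis_repr]
  rcases lt_or_ge i 0 with hi | hi
  · rw [hg i hi, mul_zero]
  · have : inner ℂ x (fourierBasis (T := 2 * Real.pi) i) = 0 := by
      rw [← inner_conj_symm, ← HilbertBasis.repr_apply_apply, fourierBasis_repr,
        fourierCoeff_congr_ae hcm.coeFn_toLp, fourierCoeff, ← integral_conj]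
      obtain ⟨k, rfl⟩ := Int.eq_ofNat_of_zero_le hi
      have h2 := ((BddBoundary.monomial k).mul hb).integral
      simp only [pow_one, zero_mul, mul_zero] at h2
      rw [← h2]
      refine integral_congr_ae (Eventually.of_forall fun t => ?_)
      simp only [smul_eq_mul, map_mul, Complex.conj_conj, fourier_neg]
    rw [this, zero_mul]

/-- The difference quotient of a bounded analytic function is bounded analytic. -/
lemma BddBoundary.dslope {F u} (h : BddBoundary F u) {l : ℂ} (hl : l ∈ Disc) :
    BddBoundary (dslope F l) (fun t => (u t - F l) / ((AddCircle.toCircle t : ℂ) - l)) where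
  diff := (Complex.differentiableOn_dslope (isOpen_ball.mem_nhds hl)).2 h.diff
  bdd := by
    have hd : DifferentiableOn ℂ (_root_.dslope F l) Disc :=
      (Complex.differentiableOn_dslope (isOpen_ball.mem_nhds hl)).2 h.diff
    obtain ⟨M, hM⟩ := h.bdd
    obtain ⟨e, he, hs⟩ := Metric.isOpen_iff.1 isOpen_ball l hl
    obtain ⟨N, hN⟩ := (isCompact_closedBall l (e / 2)).exists_bound_of_continuousOn
      (hd.continuousOn.mono ((closedBall_subset_ball (by linarith)).trans hs))
    refine ⟨max N ((M + M) / (e / 2)), fun z hz => ?_⟩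
    by_cases hzl : z ∈ closedBall l (e / 2)
    · exact (hN z hzl).trans (le_max_left _ _)
    · refine le_trans ?_ (le_max_right _ _)
      have hd2 : e / 2 < ‖z - l‖ := by
        rw [mem_closedBall, not_le, dist_eq_norm] at hzl
        exact hzl
      have hne : z ≠ l := by
        rintro rfl
        simp at hd2
        linarith
      rw [dslope_of_ne _ hne, slope_def_field, norm_div]
      have : ‖F z - F l‖ ≤ M + M := (norm_sub_le _ _).trans (add_le_add (hM z hz) (hM l hl))
      exact div_le_div₀ ((norm_nonneg _).trans this) this (by linarith) hd2.le
  lim := by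
    filter_upwards [h.lim] with t ht
    have hl1 : ‖l‖ < 1 := by simpa using hl
    have hne : (AddCircle.toCircle t : ℂ) - l ≠ 0 := by
      intro h0
      rw [sub_eq_zero] at h0
      rw [← h0, Circle.norm_coe] at hl1
      exact lt_irrefl _ hl1
    have hcont : Tendsto (fun r : ℝ => (r : ℂ) * (AddCircle.toCircle t : ℂ)) (𝓝[<] 1)
        (𝓝 (AddCircle.toCircle t : ℂ)) := by
      have : Continuous (fun r : ℝ => (r : ℂ) * (AddCircle.toCircle t : ℂ)) := by fun_prop
      have h2 := this.tendsto 1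
      simp only [Complex.ofReal_one, one_mul] at h2
      exact h2.mono_left nhdsWithin_le_nhds
    have h3 := (ht.sub_const (F l)).div (hcont.sub_const l) hne
    refine h3.congr' ?_
    have h4 := (hcont.sub_const l).eventually_ne hne
    filter_upwards [h4] with r hr
    rw [dslope_of_ne _ (sub_ne_zero.1 hr), slope_def_field]
    rfl

/-! ### Inner functions, model spaces, kernels -/

namespace InnerFunction

variable (Θ : InnerFunction)

/-- The boundary function of an inner function. -/
abbrev bdry : Circ → ℂ := radialLimit Θ.toFun

/-- `Θ` is not constant on the disc. -/
def Nonconstant : Prop := ¬ ∃ c : ℂ, ∀ z ∈ Disc, Θ.toFun z = c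

/-- A singular inner function: a nonconstant inner function without zeros in the disc. -/
def IsSingular : Prop := Θ.Nonconstant ∧ ∀ z ∈ Disc, Θ.toFun z ≠ 0

lemma bddBoundary : BddBoundary Θ.toFun Θ.bdry where
  diff := Θ.analytic
  bdd := Θ.bounded
  lim := by
    filter_upwards [Θ.radial] with t ht
    obtain ⟨w, _, hw⟩ := ht
    exact tendsto_nhds_limUnder ⟨w, hw⟩

lemma norm_bdry : ∀ᵐ t ∂m, ‖Θ.bdry t‖ = 1 := by
  filter_upwards [Θ.radial] with t ht
  obtain ⟨w, hw1, hw⟩ := ht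
  rw [bdry, radialLimit, hw.limUnder_eq, hw1]

end InnerFunction

variable (Θ : InnerFunction)

/-- The subspace `Θ H²` of `L²`. -/
def thetaH2 : Submodule ℂ L2 where
  carrier := {h | ∃ g ∈ H2, (h : Circ → ℂ) =ᵐ[m] fun t => Θ.bdry t * (g : Circ → ℂ) t}
  add_mem' := by
    rintro a b ⟨f, hf, h1⟩ ⟨g, hg, h2⟩
    refine ⟨f + g, H2.add_mem hf hg, ?_⟩
    filter_upwards [h1, h2, Lp.coeFn_add a b, Lp.coeFn_add f g] with t e1 e2 e3 e4
    rw [e3, e4, Pi.add_apply, Pi.add_apply, e1, e2, mul_add]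
  zero_mem' := by
    refine ⟨0, H2.zero_mem, ?_⟩
    filter_upwards [Lp.coeFn_zero ℂ 2 m] with t ht
    simp
  smul_mem' := by
    rintro c a ⟨f, hf, h1⟩
    refine ⟨c • f, H2.smul_mem c hf, ?_⟩
    filter_upwards [h1, Lp.coeFn_smul c a, Lp.coeFn_smul c f] with t e1 e3 e4
    rw [e3, e4, Pi.smul_apply, Pi.smul_apply, e1, smul_eq_mul, smul_eq_mul]
    ring

/-- The model space `K_Θ = H² ⊖ Θ H²`. -/
def modelSpace : Submodule ℂ L2 := H2 ⊓ (thetaH2 Θ)ᗮ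

lemma isClosed_H2 : IsClosed (H2 : Set L2) := by
  have : (H2 : Set L2) = ⋂ (n : ℤ) (_ : n < 0), {f : L2 | fourierBasis.repr f n = 0} := by
    ext f
    simp only [mem_iInter, mem_ofPred_eq, fourierBasis_repr]
    rfl
  rw [this]
  refine isClosed_iInter fun n => isClosed_iInter fun _ => ?_
  refine isClosed_eq ?_ continuous_const
  simp only [HilbertBasis.repr_apply_apply]
  fun_prop

instance : CompleteSpace (modelSpace Θ) := by
  have : IsClosed (modelSpace Θ : Set L2) :=
    isClosed_H2.inter (Submodule.isClosed_orthogonal _)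
  exact this.completeSpace_coe

/-- The orthogonal projection `P_Θ` of `L²` onto `K_Θ`. -/
def proj : L2 →L[ℂ] modelSpace Θ := (modelSpace Θ).orthogonalProjectionOnto

/-- The subspace `K_Θ ∩ H^∞` of `K_Θ`, consisting of the functions that are essentially bounded
on the circle. -/
def bddModel : Submodule ℂ (modelSpace Θ) where
  carrier := {f | MemLp ((f : L2) : Circ → ℂ) ∞ m}
  add_mem' := by
    intro a b ha hb
    exact (memLp_congr_ae (Lp.coeFn_add (a : L2) (b : L2))).2 (ha.add hb)
  zero_mem' := (memLp_congr_ae (Lp.coeFn_zero ℂ 2 m)).2 MemLp.zero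
  smul_mem' := by
    intro c a ha
    exact (memLp_congr_ae (Lp.coeFn_smul c (a : L2))).2 (ha.const_smul c)

lemma memLp_symbol_mul (φ : L2) (f : bddModel Θ) :
    MemLp (fun t => (φ : Circ → ℂ) t * ((f : modelSpace Θ) : L2) t) 2 m :=
  MemLp.mul' (p := 2) (q := ∞) (r := 2) f.2 (Lp.memLp φ)

/-- The truncated Toeplitz operator `A_φ^Θ` with symbol `φ ∈ L²`, with domain `K_Θ ∩ H^∞`:
`A_φ^Θ f = P_Θ (φ f)`. -/
def tto (φ : L2) : bddModel Θ →ₗ[ℂ] modelSpace Θ where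
  toFun f := proj Θ ((memLp_symbol_mul Θ φ f).toLp _)
  map_add' f g := by
    rw [← map_add]
    congr 1
    rw [← MemLp.toLp_add, MemLp.toLp_eq_toLp_iff]
    filter_upwards [Lp.coeFn_add ((f : modelSpace Θ) : L2) ((g : modelSpace Θ) : L2)] with t ht
    have : (((f + g : bddModel Θ) : modelSpace Θ) : L2) t
        = ((f : modelSpace Θ) : L2) t + ((g : modelSpace Θ) : L2) t := ht
    rw [this, Pi.add_apply, mul_add]
  map_smul' c f := by
    rw [RingHom.id_apply, ← map_smul]
    congr 1
    rw [← MemLp.toLp_const_smul, MemLp.toLp_eq_toLp_iff]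
    filter_upwards [Lp.coeFn_smul c ((f : modelSpace Θ) : L2)] with t ht
    have : (((c • f : bddModel Θ) : modelSpace Θ) : L2) t
        = c * ((f : modelSpace Θ) : L2) t := ht
    rw [this, Pi.smul_apply, smul_eq_mul]
    ring

/-- The (possibly only densely defined) operator `T` is bounded. -/
def IsBddOp (T : bddModel Θ →ₗ[ℂ] modelSpace Θ) : Prop :=
  ∃ C : ℝ, ∀ f : bddModel Θ, ‖T f‖ ≤ C * ‖(f : modelSpace Θ)‖

/-- Boundary values of the reproducing kernel
`k_λ^Θ (z) = (1 - conj (Θ λ) Θ z) / (1 - conj λ z)`. -/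
def kernelFun (l : ℂ) (t : Circ) : ℂ :=
  (1 - conj (Θ.toFun l) * Θ.bdry t) / (1 - conj l * (AddCircle.toCircle t : ℂ))

lemma one_sub_ne_zero {l z : ℂ} (hl : l ∈ Disc) (hz : ‖z‖ ≤ 1) : 1 - conj l * z ≠ 0 := by
  intro h
  have h1 : conj l * z = 1 := (sub_eq_zero.1 h).symm
  have h2 : ‖l‖ * ‖z‖ = 1 := by
    have := congrArg norm h1
    rwa [norm_mul, RCLike.norm_conj, norm_one] at this
  have hl1 : ‖l‖ < 1 := by simpa using hl
  nlinarith [norm_nonneg l, norm_nonneg z]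

lemma kernel_bddBoundary {l : ℂ} (hl : l ∈ Disc) :
    BddBoundary (fun z => (1 - conj (Θ.toFun l) * Θ.toFun z) * (1 - conj l * z)⁻¹)
      (kernelFun Θ l) := by
  have h1 : BddBoundary (fun z => 1 - conj (Θ.toFun l) * Θ.toFun z)
      (fun t => 1 - conj (Θ.toFun l) * Θ.bdry t) := by
    have h0 := Θ.bddBoundary
    refine ⟨(h0.diff.const_mul _).const_sub _, ?_, ?_⟩
    · obtain ⟨M, hM⟩ := h0.bdd
      refine ⟨1 + ‖Θ.toFun l‖ * M, fun z hz => (norm_sub_le _ _).trans ?_⟩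
      rw [norm_one, norm_mul, RCLike.norm_conj]
      gcongr
      exact hM z hz
    · filter_upwards [h0.lim] with t ht using (ht.const_mul _).const_sub _
  have h2 := BddBoundary.of_continuousOn (F := fun z => (1 - conj l * z)⁻¹)
    (DifferentiableOn.inv (by fun_prop) fun z hz =>
      one_sub_ne_zero hl (by simpa using (ball_subset_closedBall hz)))
    (ContinuousOn.inv₀ (by fun_prop) fun z hz => one_sub_ne_zero hl (by simpa using hz))
  exact h1.mul h2

/-- The reproducing kernel `k_λ^Θ` as an element of `L²`. -/
def kernelL2 (l : Disc) : L2 := ((kernel_bddBoundary Θ l.2).memLp 2).toLp (kernelFun Θ l)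

lemma kernelL2_mem (l : Disc) : kernelL2 Θ l ∈ modelSpace Θ := by
  refine ⟨(kernel_bddBoundary Θ l.2).toLp_mem_H2, ?_⟩
  rw [SetLike.mem_coe, Submodule.mem_orthogonal']
  rintro h ⟨g, hg, hh⟩
  rw [L2.inner_def, ← (Θ.bddBoundary.dslope l.2).integral_mul_H2 hg]
  refine integral_congr_ae ?_
  filter_upwards [((kernel_bddBoundary Θ l.2).memLp 2).coeFn_toLp, hh, Θ.norm_bdry]
    with t h1 h2 h3
  rw [kernelL2, h1, h2, RCLike.inner_apply', kernelFun]
  have hu : conj (Θ.bdry t) * Θ.bdry t = 1 := by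
    rw [← Complex.normSq_eq_conj_mul_self, Complex.normSq_eq_norm_sq, h3]
    norm_num
  have he1 : conj (AddCircle.toCircle t : ℂ) * (AddCircle.toCircle t : ℂ) = 1 := by
    rw [← Complex.normSq_eq_conj_mul_self, Complex.normSq_eq_norm_sq, Circle.norm_coe]
    norm_num
  have hn1 : 1 - (l : ℂ) * conj (AddCircle.toCircle t : ℂ) ≠ 0 := by
    intro h0
    apply one_sub_ne_zero l.2 (z := (AddCircle.toCircle t : ℂ)) (Circle.norm_coe _).le
    have := congrArg conj h0
    simpa using this
  have hn2 : (AddCircle.toCircle t : ℂ) - l ≠ 0 := by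
    intro h0
    apply hn1
    rw [← sub_eq_zero.1 h0, mul_comm, he1, sub_self]
  simp only [map_div₀, map_sub, map_mul, map_one, Complex.conj_conj, fourier_one]
  rw [div_mul_eq_mul_div, mul_div_assoc', div_mul_eq_mul_div, div_eq_div_iff hn1 hn2]
  generalize (AddCircle.toCircle t : ℂ) = e at *
  generalize Θ.bdry t = u at *
  linear_combination
    (-(Θ.toFun l) * (e - l) * g t) * hu + (u - Θ.toFun l) * (l : ℂ) * g t * he1

/-- The normalised reproducing kernel `h_λ^Θ = √((1 - |λ|²) / (1 - |Θ λ|²)) k_λ^Θ`, as an element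
of `K_Θ ∩ H^∞`. -/
def normKernel (l : Disc) : bddModel Θ :=
  ((Real.sqrt ((1 - ‖(l : ℂ)‖ ^ 2) / (1 - ‖Θ.toFun l‖ ^ 2)) : ℝ) : ℂ) •
    (⟨⟨kernelL2 Θ l, kernelL2_mem Θ l⟩,
      (memLp_congr_ae ((kernel_bddBoundary Θ l.2).memLp 2).coeFn_toLp).2
        ((kernel_bddBoundary Θ l.2).memLp ∞)⟩ : bddModel Θ)

/-- `ρ_r(T) = sup_{λ ∈ 𝔻} ‖T h_λ^Θ‖ ∈ [0, ∞]`. -/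
def rhoR (T : bddModel Θ →ₗ[ℂ] modelSpace Θ) : ℝ≥0∞ :=
  ⨆ l : Disc, ‖T (normKernel Θ l)‖ₑ

/-- The restriction to `K_Θ ∩ H^∞` of an everywhere defined bounded operator on `K_Θ`. -/
def restr (A : modelSpace Θ →L[ℂ] modelSpace Θ) : bddModel Θ →ₗ[ℂ] modelSpace Θ :=
  (A : modelSpace Θ →ₗ[ℂ] modelSpace Θ) ∘ₗ (bddModel Θ).subtype

lemma tto_add (φ ψ : L2) : tto Θ (φ + ψ) = tto Θ φ + tto Θ ψ := by
  ext1 f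
  change proj Θ _ = proj Θ _ + proj Θ _
  rw [← map_add]
  congr 1
  rw [← MemLp.toLp_add, MemLp.toLp_eq_toLp_iff]
  filter_upwards [Lp.coeFn_add φ ψ] with t ht
  rw [ht, Pi.add_apply, Pi.add_apply, add_mul]

lemma tto_smul (c : ℂ) (φ : L2) : tto Θ (c • φ) = c • tto Θ φ := by
  ext1 f
  change proj Θ _ = c • proj Θ _
  rw [← map_smul]
  congr 1
  rw [← MemLp.toLp_const_smul, MemLp.toLp_eq_toLp_iff]
  filter_upwards [Lp.coeFn_smul c φ] with t ht
  rw [ht, Pi.smul_apply, Pi.smul_apply, smul_eq_mul, smul_eq_mul, mul_assoc]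

/-- The space `𝒯(K_Θ)` of all bounded truncated Toeplitz operators on `K_Θ`: the bounded operators
on `K_Θ` that agree on `K_Θ ∩ H^∞` with `A_φ^Θ` for some `φ ∈ L²`. Its norm is the operator norm. -/
def bddTTO : Submodule ℂ (modelSpace Θ →L[ℂ] modelSpace Θ) where
  carrier := {A | ∃ φ : L2, restr Θ A = tto Θ φ}
  add_mem' := by
    rintro A B ⟨φ, h1⟩ ⟨ψ, h2⟩
    exact ⟨φ + ψ, by rw [tto_add, ← h1, ← h2]; rfl⟩
  zero_mem' := ⟨0, by
    have := tto_smul Θ 0 0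
    rw [zero_smul, zero_smul] at this
    rw [this]; rfl⟩
  smul_mem' := by
    rintro c A ⟨φ, h1⟩
    exact ⟨c • φ, by rw [tto_smul, ← h1]; rfl⟩

/-- `ρ_r` on `𝒯(K_Θ)`. -/
def rhoT (A : bddTTO Θ) : ℝ≥0∞ := rhoR Θ (restr Θ (A : modelSpace Θ →L[ℂ] modelSpace Θ))

end TruncToep

end

noncomputable section

namespace TruncToep

/-! ### Square integrable functions with one-sided spectrum -/

/-! Everything rests on recovering a symbol continuously from finitely many kernel values. Symbols
in `Θ H² + conj (Θ H²)` give the zero operator (`tto_eq_zero`). Modulo these, a symbol of `A_φ` is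
obtained by a bounded linear formula from the values of `A_φ` at two kernels `k_λ`, `k_λ'` with `Θ λ
≠ Θ λ'` (`exists_symbol_mod_const`, `exists_symbol`).

Encode an operator with finite `ρ_r` by the family of its values at all normalised kernels, an
element of an `ℓ^∞` space whose norm is `ρ_r`. With `S` the bounded symbol recovery, the families
`g` whose entries are the values of the operator with symbol `S g` form a closed subspace, since
each such condition is continuous in `g`. So this is a Banach space (`isClosed_orbitSpace`).

If finite `ρ_r` forces boundedness, then for each `g` the vectors `A_{S g} f / ‖f‖` are bounded over
`f`, and Banach–Steinhaus yields one constant `M` for all symbols (`exists_uniform_bound`). This is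
the equivalence of `ρ_r` with the norm; the bound `ρ_r ≤ ‖·‖` holds because the normalised kernels
have norm at most one. For completeness, a `ρ_r`-Cauchy sequence converges in the closed subspace,
and the assumption makes the operator with the limit symbol bounded (`exists_tendsto_rhoT`).

For a singular `Θ` no such `M` exists. Take an inner root `ω` with `ω ^ (N + 1) = Θ` and the symbol
`conj (ω ^ N)`. On normalised kernels the squared norm is `y ^ N (1 - y) / (1 - y ^ (N + 1)) ≤ 1 /
(N + 1)` with `y = |ω λ|²` (`norm_tto_conjPow_sq_le`), yet the operator preserves the norm of some
nonzero vector (`exists_norm_tto_conjPow_eq`). The unbounded operator is thus obtained by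
contradiction, not explicitly. -/

/-- A function on the circle representing an element of `H²`. -/
structure IsHardy (f : Circ → ℂ) : Prop where
  memLp : MemLp f 2 m
  coeff : ∀ n : ℤ, n < 0 → fourierCoeff f n = 0

/-- A function on the circle representing an element of `L² ⊖ H²`. -/
structure IsAntiHardy (f : Circ → ℂ) : Prop where
  memLp : MemLp f 2 m
  coeff : ∀ n : ℤ, 0 ≤ n → fourierCoeff f n = 0

lemma fourierCoeff_memLp_toLp {f : Circ → ℂ} (h : MemLp f 2 m) (n : ℤ) :
    fourierCoeff (h.toLp f : Circ → ℂ) n = fourierCoeff f n := by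
  rw [fourierCoeff_congr_ae h.coeFn_toLp]

lemma mem_H2_iff {f : L2} : f ∈ H2 ↔ IsHardy f :=
  ⟨fun h => ⟨Lp.memLp f, h⟩, fun h => h.coeff⟩

lemma inner_toLp {f g : Circ → ℂ} (hf : MemLp f 2 m) (hg : MemLp g 2 m) :
    inner ℂ (hf.toLp f) (hg.toLp g) = ∫ t, conj (f t) * g t ∂m := by
  rw [L2.inner_def]
  refine integral_congr_ae ?_
  filter_upwards [hf.coeFn_toLp, hg.coeFn_toLp] with t h1 h2
  rw [h1, h2, RCLike.inner_apply']

lemma inner_eq_integral (f g : L2) : inner ℂ f g = ∫ t, conj (f t) * g t ∂m := by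
  rw [L2.inner_def]
  exact integral_congr_ae (Eventually.of_forall fun t => RCLike.inner_apply' _ _)

/-- Functions with disjoint spectra are orthogonal. -/
lemma integral_conj_mul_eq_zero {f g : Circ → ℂ} (hf : MemLp f 2 m) (hg : MemLp g 2 m)
    (h : ∀ n, fourierCoeff f n = 0 ∨ fourierCoeff g n = 0) :
    ∫ t, conj (f t) * g t ∂m = 0 := by
  rw [← inner_toLp hf hg, ← fourierBasis.tsum_inner_mul_inner]
  refine (tsum_congr fun i => ?_).trans tsum_zero
  rw [← inner_conj_symm, ← HilbertBasis.repr_apply_apply, ← HilbertBasis.repr_apply_apply,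
    fourierBasis_repr, fourierBasis_repr, fourierCoeff_memLp_toLp, fourierCoeff_memLp_toLp]
  rcases h i with h | h <;> simp [h]

lemma ext_fourierCoeff {f : L2} (h : ∀ n, fourierCoeff (f : Circ → ℂ) n = 0) : f = 0 := by
  have : fourierBasis.repr f = 0 := by
    ext n
    rw [fourierBasis_repr, h n]
    rfl
  simpa using this

lemma fourierCoeff_conj (f : Circ → ℂ) (n : ℤ) :
    fourierCoeff (fun t => conj (f t)) n = conj (fourierCoeff f (-n)) := by
  rw [fourierCoeff, fourierCoeff, ← integral_conj]
  refine integral_congr_ae (Eventually.of_forall fun t => ?_)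
  simp only [smul_eq_mul, map_mul, fourier_neg, Complex.conj_conj]

lemma fourierCoeff_fourier_mul (f : Circ → ℂ) (k n : ℤ) :
    fourierCoeff (fun t => fourier k t * f t) n = fourierCoeff f (n - k) := by
  rw [fourierCoeff, fourierCoeff]
  refine integral_congr_ae (Eventually.of_forall fun t => ?_)
  simp only [smul_eq_mul]
  rw [← mul_assoc, ← fourier_add, neg_sub, sub_eq_neg_add]

lemma memLp_fourier (k : ℤ) (p : ℝ≥0∞) : MemLp (fun t : Circ => fourier k t) p m :=
  (fourier k).continuous.memLp_of_hasCompactSupport (HasCompactSupport.of_compactSpace _)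

lemma memLp_bdd_mul {u f : Circ → ℂ} (hu : MemLp u ∞ m) (hf : MemLp f 2 m) :
    MemLp (fun t => u t * f t) 2 m :=
  MemLp.mul' (p := ∞) (q := 2) (r := 2) hf hu

lemma memLp_conj {f : Circ → ℂ} {p : ℝ≥0∞} (h : MemLp f p m) :
    MemLp (fun t => conj (f t)) p m := h.star

lemma integrable_of_memLp {f : Circ → ℂ} (h : MemLp f 2 m) : Integrable f m :=
  h.integrable (by norm_num)

namespace IsHardy

variable {f g : Circ → ℂ}

lemma congr (hf : IsHardy f) (h : f =ᵐ[m] g) : IsHardy g :=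
  ⟨(memLp_congr_ae h).1 hf.memLp, fun n hn => by rw [← fourierCoeff_congr_ae h, hf.coeff n hn]⟩

lemma toLp_mem (hf : IsHardy f) : hf.memLp.toLp f ∈ H2 :=
  mem_H2_iff.2 (hf.congr hf.memLp.coeFn_toLp.symm)

lemma const_mul (hf : IsHardy f) (c : ℂ) : IsHardy fun t => c * f t :=
  ⟨hf.memLp.const_mul c, fun n hn => by rw [fourierCoeff.const_mul, hf.coeff n hn, mul_zero]⟩

lemma add (hf : IsHardy f) (hg : IsHardy g) : IsHardy fun t => f t + g t :=
  ⟨hf.memLp.add hg.memLp, fun n hn => by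
    have := congrFun (fourierCoeff.add (integrable_of_memLp hf.memLp)
      (integrable_of_memLp hg.memLp)) n
    exact this.trans (by rw [Pi.add_apply, hf.coeff n hn, hg.coeff n hn, add_zero])⟩

lemma sub (hf : IsHardy f) (hg : IsHardy g) : IsHardy fun t => f t - g t :=
  (hf.add (hg.const_mul (-1))).congr (Eventually.of_forall fun t => by simp only; ring)

lemma fourier_nonneg {k : ℤ} (hk : 0 ≤ k) : IsHardy fun t => fourier k t := by
  obtain ⟨n, rfl⟩ := Int.eq_ofNat_of_zero_le hk
  exact ⟨memLp_fourier _ _, fun j hj => (BddBoundary.monomial n).coeff_neg hj⟩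

/-- The product of two functions in `H²` has no spectrum on the negative half-line. -/
lemma fourierCoeff_mul (hf : IsHardy f) (hg : IsHardy g) {n : ℤ} (hn : n < 0) :
    fourierCoeff (fun t => f t * g t) n = 0 := by
  -- The product is only integrable, so its coefficient is read as the pairing of `g` with `conj
  -- (z^(-n) f)`, whose spectrum is negative because `n < 0`.
  have h1 : MemLp (fun t => conj (fourier (-n) t * f t)) 2 m :=
    memLp_conj (memLp_bdd_mul (memLp_fourier _ _) hf.memLp)
  rw [fourierCoeff, ← integral_conj_mul_eq_zero h1 hg.memLp fun k => ?_]
  · refine integral_congr_ae (Eventually.of_forall fun t => ?_)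
    simp only [smul_eq_mul, Complex.conj_conj]
    ring
  · rcases lt_or_ge k 0 with hk | hk
    · exact Or.inr (hg.coeff k hk)
    · left
      rw [fourierCoeff_conj (fun t => fourier (-n) t * f t), fourierCoeff_fourier_mul,
        hf.coeff _ (by lia), map_zero]

lemma mul (hf : IsHardy f) (hg : IsHardy g) (hb : MemLp f ∞ m) : IsHardy fun t => f t * g t :=
  ⟨memLp_bdd_mul hb hg.memLp, fun _ hn => hf.fourierCoeff_mul hg hn⟩

/-- `conj (z f)` is orthogonal to `H²` for `f ∈ H²`. -/
lemma isAntiHardy_conj (hf : IsHardy f) : IsAntiHardy fun t => conj (fourier 1 t * f t) := by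
  refine ⟨memLp_conj (memLp_bdd_mul (memLp_fourier _ _) hf.memLp), fun n hn => ?_⟩
  rw [fourierCoeff_conj (fun t => fourier 1 t * f t), fourierCoeff_fourier_mul,
    hf.coeff _ (by lia), map_zero]

lemma integral_conj_mul_anti (hf : IsHardy f) (hg : IsAntiHardy g) :
    ∫ t, conj (f t) * g t ∂m = 0 :=
  integral_conj_mul_eq_zero hf.memLp hg.memLp fun n =>
    (lt_or_ge n 0).imp (hf.coeff n) (hg.coeff n)

lemma mul' (hg : IsHardy g) (hb : MemLp f ∞ m) (hf : IsHardy f) : IsHardy fun t => f t * g t :=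
  hf.mul hg hb

end IsHardy

lemma BddBoundary.isHardy {F : ℂ → ℂ} {u : Circ → ℂ} (h : BddBoundary F u) :
    IsHardy u := ⟨h.memLp 2, fun _ hn => h.coeff_neg hn⟩

namespace IsAntiHardy

variable {f g : Circ → ℂ}

lemma congr (hf : IsAntiHardy f) (h : f =ᵐ[m] g) : IsAntiHardy g :=
  ⟨(memLp_congr_ae h).1 hf.memLp, fun n hn => by rw [← fourierCoeff_congr_ae h, hf.coeff n hn]⟩

/-- The antilinear involution `f ↦ conj (z f)` sends the index `n` to `-n - 1`, so it exchanges `H²`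
and its orthogonal complement. -/
lemma isHardy_conj (hf : IsAntiHardy f) : IsHardy fun t => conj (fourier 1 t * f t) := by
  refine ⟨memLp_conj (memLp_bdd_mul (memLp_fourier _ _) hf.memLp), fun n hn => ?_⟩
  rw [fourierCoeff_conj (fun t => fourier 1 t * f t), fourierCoeff_fourier_mul,
    hf.coeff _ (by lia), map_zero]

/-- Multiplication by the conjugate of a function in `H²` preserves `L² ⊖ H²`. -/
lemma conj_mul (hf : IsAntiHardy f) (hb : MemLp f ∞ m) (hg : IsHardy g) :
    IsAntiHardy fun t => conj (g t) * f t := by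
  have hb' : MemLp (fun t => conj (fourier 1 t * f t)) ∞ m :=
    memLp_conj (MemLp.mul' (p := ∞) (q := ∞) (r := ∞) hb (memLp_fourier 1 ∞))
  refine (hf.isHardy_conj.mul hg hb').isAntiHardy_conj.congr (Eventually.of_forall fun t => ?_)
  have : (fourier (-1) t : ℂ) * fourier 1 t = 1 := by rw [← fourier_add]; simp
  simp only [map_mul, Complex.conj_conj, ← fourier_neg, neg_neg]
  linear_combination (f t * conj (g t)) * this

/-- Multiplication by `1 - l z` maps `L² ⊖ H²` into the conjugate of `H²`. -/
lemma exists_isHardy (hf : IsAntiHardy f) (l : ℂ) :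
    ∃ g, IsHardy g ∧ ∀ t, (1 - l * fourier 1 t) * f t = conj (g t) := by
  have h := hf.isHardy_conj
  -- With `h = conj (z f)` the witness is `z h - conj l h`. The factor `1 - l z` can move the index
  -- `-1` to `0`, so a constant term may appear and the result lies in `conj H²` only.
  refine ⟨_, ((h.mul' (memLp_fourier 1 ∞) (IsHardy.fourier_nonneg zero_le_one)).sub
    (h.const_mul (conj l))), fun t => ?_⟩
  have : (fourier (-1) t : ℂ) * fourier 1 t = 1 := by rw [← fourier_add]; simp
  simp only [map_mul, map_sub, Complex.conj_conj, ← fourier_neg, neg_neg]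
  linear_combination (-f t) * this

end IsAntiHardy

/-- An element of `L²` orthogonal to `H²`. -/
lemma isAntiHardy_of_mem_orthogonal {f : L2} (hf : f ∈ H2ᗮ) : IsAntiHardy f := by
  refine ⟨Lp.memLp f, fun n hn => ?_⟩
  rw [← fourierBasis_repr, HilbertBasis.repr_apply_apply]
  refine (Submodule.mem_orthogonal _ _).1 hf _ (mem_H2_iff.2 ?_)
  rw [coe_fourierBasis]
  exact (IsHardy.fourier_nonneg hn).congr (coeFn_fourierLp 2 n).symm

lemma IsAntiHardy.mem_orthogonal {f : L2} (hf : IsAntiHardy f) : f ∈ H2ᗮ := by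
  refine (Submodule.mem_orthogonal _ _).2 fun g hg => ?_
  rw [inner_eq_integral]
  exact (mem_H2_iff.1 hg).integral_conj_mul_anti hf

instance : CompleteSpace H2 := isClosed_H2.completeSpace_coe

/-- The decomposition `L² = H² ⊕ (L² ⊖ H²)` on the level of functions. -/
lemma exists_isHardy_add_isAntiHardy {f : Circ → ℂ} (hf : MemLp f 2 m) :
    ∃ g h, IsHardy g ∧ IsAntiHardy h ∧ f =ᵐ[m] fun t => g t + h t := by
  set x : L2 := hf.toLp f
  refine ⟨_, _, mem_H2_iff.1 (H2.orthogonalProjectionOnto x).2,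
    isAntiHardy_of_mem_orthogonal (H2.sub_starProjection_mem_orthogonal x), ?_⟩
  filter_upwards [hf.coeFn_toLp, Lp.coeFn_sub x (H2.starProjection x)] with t h1 h2
  rw [h2, Pi.sub_apply, Submodule.coe_orthogonalProjectionOnto_apply, ← h1]
  ring

end TruncToep

end

noncomputable section

namespace TruncToep

/-! ### The projection onto the model space -/

variable (Θ : InnerFunction)

lemma InnerFunction.conj_bdry_mul_bdry : ∀ᵐ t ∂m, conj (Θ.bdry t) * Θ.bdry t = 1 := by
  filter_upwards [Θ.norm_bdry] with t ht
  rw [← Complex.normSq_eq_conj_mul_self, Complex.normSq_eq_norm_sq, ht]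
  norm_num

lemma InnerFunction.memLp_conj_bdry (p : ℝ≥0∞) : MemLp (fun t => conj (Θ.bdry t)) p m :=
  memLp_conj (Θ.bddBoundary.memLp p)

lemma IsHardy.bdry_mul {g : Circ → ℂ} (hg : IsHardy g) : IsHardy fun t => Θ.bdry t * g t :=
  Θ.bddBoundary.isHardy.mul hg (Θ.bddBoundary.memLp ∞)

lemma IsHardy.toLp_bdry_mul_mem {g : Circ → ℂ} (hg : IsHardy g) :
    (hg.bdry_mul Θ).memLp.toLp _ ∈ thetaH2 Θ := by
  refine ⟨_, hg.toLp_mem, ?_⟩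
  filter_upwards [(hg.bdry_mul Θ).memLp.coeFn_toLp, hg.memLp.coeFn_toLp] with t h1 h2
  rw [h1, h2]

/-- `K_Θ` consists of the `f ∈ H²` with `conj Θ f ∈ L² ⊖ H²`. -/
lemma mem_modelSpace_iff {f : L2} : f ∈ modelSpace Θ ↔
    IsHardy f ∧ IsAntiHardy fun t => conj (Θ.bdry t) * f t := by
  have hm : MemLp (fun t => conj (Θ.bdry t) * f t) 2 m :=
    memLp_bdd_mul (Θ.memLp_conj_bdry ∞) (Lp.memLp f)
  refine and_congr mem_H2_iff ⟨fun h => ⟨hm, fun n hn => ?_⟩, fun h => ?_⟩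
  · have hg := (IsHardy.fourier_nonneg hn)
    have := (Submodule.mem_orthogonal _ _).1 h _ (hg.toLp_bdry_mul_mem Θ)
    rw [inner_eq_integral] at this
    rw [fourierCoeff, ← this]
    refine integral_congr_ae ?_
    filter_upwards [(hg.bdry_mul Θ).memLp.coeFn_toLp] with t h1
    rw [h1, map_mul, smul_eq_mul, fourier_neg]
    ring
  · refine (Submodule.mem_orthogonal _ _).2 ?_
    rintro x ⟨g, hg, hx⟩
    rw [inner_eq_integral, ← (mem_H2_iff.1 hg).integral_conj_mul_anti h]
    refine integral_congr_ae ?_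
    filter_upwards [hx] with t h1
    rw [h1, map_mul]
    ring

variable {Θ} in
lemma isHardy_of_mem {f : L2} (hf : f ∈ modelSpace Θ) : IsHardy f :=
  ((mem_modelSpace_iff Θ).1 hf).1

variable {Θ} in
lemma isAntiHardy_of_mem {f : L2} (hf : f ∈ modelSpace Θ) :
    IsAntiHardy fun t => conj (Θ.bdry t) * f t :=
  ((mem_modelSpace_iff Θ).1 hf).2

lemma toLp_mem_modelSpace {f : Circ → ℂ} (hf : IsHardy f)
    (h : IsAntiHardy fun t => conj (Θ.bdry t) * f t) : hf.memLp.toLp f ∈ modelSpace Θ := by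
  refine (mem_modelSpace_iff Θ).2 ⟨hf.congr hf.memLp.coeFn_toLp.symm, h.congr ?_⟩
  filter_upwards [hf.memLp.coeFn_toLp] with t h1
  rw [h1]

/-- The decomposition `L² = K_Θ ⊕ Θ H² ⊕ (L² ⊖ H²)` determines the projection onto `K_Θ`. -/
lemma proj_eq {ψ k : L2} {h a : Circ → ℂ} (hk : k ∈ modelSpace Θ)
    (hh : IsHardy h) (ha : IsAntiHardy a)
    (e : ψ =ᵐ[m] fun t => k t + Θ.bdry t * h t + a t) : proj Θ ψ = ⟨k, hk⟩ := by
  have hx : ψ = k + (hh.bdry_mul Θ).memLp.toLp _ + ha.memLp.toLp a := by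
    refine Lp.ext ?_
    filter_upwards [e, Lp.coeFn_add (k + (hh.bdry_mul Θ).memLp.toLp _) (ha.memLp.toLp a),
      Lp.coeFn_add k ((hh.bdry_mul Θ).memLp.toLp _), (hh.bdry_mul Θ).memLp.coeFn_toLp,
      ha.memLp.coeFn_toLp] with t h1 h2 h3 h4 h5
    rw [h1, h2, Pi.add_apply, h3, Pi.add_apply, h4, h5]
  rw [hx, map_add, map_add, proj,
    Submodule.orthogonalProjectionOnto_mem_subspace_eq_self (⟨k, hk⟩ : modelSpace Θ),
    Submodule.orthogonalProjectionOnto_apply_of_mem_orthogonal,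
    Submodule.orthogonalProjectionOnto_apply_of_mem_orthogonal, add_zero, add_zero]
  · exact Submodule.orthogonal_le inf_le_left
      (ha.congr ha.memLp.coeFn_toLp.symm).mem_orthogonal
  · exact (Submodule.orthogonal_le inf_le_right) (Submodule.le_orthogonal_orthogonal _
      (hh.toLp_bdry_mul_mem Θ))

/-- Split `ψ = x + a` along `H²`, then split `conj Θ x = p + b` in the same way. The model space
component is `x - Θ p`, because `conj Θ (x - Θ p) = b` has negative spectrum. -/
lemma exists_decomposition (ψ : L2) : ∃ h a, IsHardy h ∧ IsAntiHardy a ∧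
    ψ =ᵐ[m] fun t => (proj Θ ψ : L2) t + Θ.bdry t * h t + a t := by
  obtain ⟨x, a, hx, ha, h1⟩ := exists_isHardy_add_isAntiHardy (Lp.memLp ψ)
  obtain ⟨p, b, hp, hb, h2⟩ := exists_isHardy_add_isAntiHardy
    (memLp_bdd_mul (Θ.memLp_conj_bdry ∞) hx.memLp)
  have hk := hx.sub (hp.bdry_mul Θ)
  have hkm := toLp_mem_modelSpace Θ hk (hb.congr (by
    filter_upwards [h2, Θ.conj_bdry_mul_bdry] with t h3 h4
    linear_combination -h3 + p t * h4))
  have e : ψ =ᵐ[m] fun t => hk.memLp.toLp _ t + Θ.bdry t * p t + a t := by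
    filter_upwards [h1, hk.memLp.coeFn_toLp] with t h3 h4
    rw [h3, h4]
    ring
  refine ⟨p, a, hp, ha, ?_⟩
  rw [proj_eq Θ hkm hp ha e]
  exact e

lemma tto_apply_eq {φ k : L2} {f : bddModel Θ} {h a : Circ → ℂ} (hk : k ∈ modelSpace Θ)
    (hh : IsHardy h) (ha : IsAntiHardy a)
    (e : (fun t => φ t * ((f : modelSpace Θ) : L2) t) =ᵐ[m]
      fun t => k t + Θ.bdry t * h t + a t) : tto Θ φ f = ⟨k, hk⟩ :=
  proj_eq Θ hk hh ha ((memLp_symbol_mul Θ φ f).coeFn_toLp.trans e)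

lemma exists_tto_decomposition (φ : L2) (f : bddModel Θ) :
    ∃ h a, IsHardy h ∧ IsAntiHardy a ∧ (fun t => φ t * ((f : modelSpace Θ) : L2) t) =ᵐ[m]
      fun t => (tto Θ φ f : L2) t + Θ.bdry t * h t + a t := by
  obtain ⟨h, a, hh, ha, e⟩ := exists_decomposition Θ ((memLp_symbol_mul Θ φ f).toLp _)
  exact ⟨h, a, hh, ha, (memLp_symbol_mul Θ φ f).coeFn_toLp.symm.trans e⟩

/-- Symbols in `Θ H² + conj (Θ H²)` give the zero operator. -/
lemma tto_eq_zero {φ : L2} {h g : Circ → ℂ} (hh : IsHardy h) (hg : IsHardy g)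
    (e : φ =ᵐ[m] fun t => Θ.bdry t * h t + conj (Θ.bdry t * g t)) : tto Θ φ = 0 := by
  ext1 f
  have hf := (f : modelSpace Θ).2
  have hfb : MemLp ((f : modelSpace Θ) : L2) ∞ m := f.2
  have hb : MemLp (fun t => conj (Θ.bdry t) * ((f : modelSpace Θ) : L2) t) ∞ m :=
    MemLp.mul' (p := ∞) (q := ∞) (r := ∞) hfb (Θ.memLp_conj_bdry ∞)
  -- Boundedness of `f` keeps both products in `L²`: `Θ h f` lies in `Θ H²`, and `conj (Θ g) f =
  -- conj g (conj Θ f)` has negative spectrum.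
  refine tto_apply_eq Θ (modelSpace Θ).zero_mem (hh.mul' hfb (isHardy_of_mem hf))
    ((isAntiHardy_of_mem hf).conj_mul hb hg) ?_
  filter_upwards [e, Lp.coeFn_zero ℂ 2 m] with t h1 h2
  rw [h1, h2, Pi.zero_apply, map_mul]
  ring

lemma tto_sub (φ ψ : L2) : tto Θ (φ - ψ) = tto Θ φ - tto Θ ψ := by
  rw [sub_eq_add_neg, sub_eq_add_neg, ← neg_one_smul ℂ ψ, tto_add, tto_smul,
    neg_one_smul ℂ (tto Θ ψ)]

/-! ### Density of the bounded functions -/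

lemma fourierCoeff_sub {f g : Circ → ℂ} (hf : MemLp f 2 m) (hg : MemLp g 2 m) (n : ℤ) :
    fourierCoeff (fun t => f t - g t) n = fourierCoeff f n - fourierCoeff g n := by
  have := congrFun (fourierCoeff.add (integrable_of_memLp hf)
    (integrable_of_memLp (hg.const_mul (-1)))) n
  rw [Pi.add_apply, fourierCoeff.const_mul] at this
  rw [sub_eq_add_neg, ← neg_one_mul, ← this]
  congr 1
  ext t
  simp [sub_eq_add_neg]

lemma fourierCoeff_sum_fourier (N : ℕ) (c : ℕ → ℂ) (n : ℤ) :
    fourierCoeff (fun t : Circ => ∑ j ∈ Finset.range N, c j * fourier (j : ℤ) t) n =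
      ∑ j ∈ Finset.range N, c j * if n = j then 1 else 0 := by
  have := congrFun (fourierCoeff.sum (Finset.range N)
    (fun (j : ℕ) (t : Circ) => c j * fourier (j : ℤ) t) fun j _ =>
      integrable_of_memLp ((memLp_fourier (j : ℤ) 2).const_mul _)) n
  rw [Finset.sum_apply] at this
  convert this using 2 with j hj
  · ext t
    rw [Finset.sum_apply]
  · rw [fourierCoeff.const_mul, fourierCoeff_fourier, Pi.single_apply]

/-- If the spectrum of `w` is bounded above, the projection of `w` to `H²` is a polynomial. -/
lemma exists_continuous_isHardy {w : Circ → ℂ} (hw : MemLp w 2 m) (N : ℕ)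
    (h : ∀ n : ℤ, N < n → fourierCoeff w n = 0) :
    ∃ p : Circ → ℂ, Continuous p ∧ IsHardy p ∧ IsAntiHardy fun t => w t - p t := by
  set p : Circ → ℂ := fun t => ∑ j ∈ Finset.range (N + 1), fourierCoeff w j * fourier (j : ℤ) t
    with hp
  have hpc : Continuous p := by fun_prop
  have hpm : MemLp p 2 m :=
    hpc.memLp_of_hasCompactSupport (HasCompactSupport.of_compactSpace _)
  refine ⟨p, hpc, ⟨hpm, fun n hn => ?_⟩, ⟨hw.sub hpm, fun n hn => ?_⟩⟩
  · rw [hp, fourierCoeff_sum_fourier (N + 1) fun j => fourierCoeff w j]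
    refine Finset.sum_eq_zero fun j _ => ?_
    rw [if_neg (by lia), mul_zero]
  · rw [fourierCoeff_sub hw hpm, hp, fourierCoeff_sum_fourier (N + 1) fun j => fourierCoeff w j]
    obtain ⟨k, rfl⟩ := Int.eq_ofNat_of_zero_le hn
    by_cases hk : k < N + 1
    · rw [Finset.sum_eq_single_of_mem k (Finset.mem_range.2 hk)
        fun j _ hj => by rw [if_neg (by lia), mul_zero], if_pos rfl, mul_one, sub_self]
    · rw [Finset.sum_eq_zero fun j hj => by
        rw [if_neg (by have := Finset.mem_range.1 hj; lia), mul_zero], sub_zero, h _ (by lia)]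

lemma integrable_conj_mul {f g : Circ → ℂ} (hf : MemLp f 2 m) (hg : MemLp g 2 m) :
    Integrable (fun t => conj (f t) * g t) m :=
  (memLp_conj hf).integrable_mul hg

/-- The projection of `z^N` to `K_Θ` is `z^N - Θ p` with `p` a polynomial, hence bounded. Pairing it
with `f ∈ K_Θ` gives the `N`-th coefficient of `f`, because `f` is orthogonal to `Θ p`. So an `f`
orthogonal to all bounded functions vanishes. -/
lemma dense_bddModel : Dense (bddModel Θ : Set (modelSpace Θ)) := by
  rw [Submodule.dense_iff_topologicalClosure_eq_top, Submodule.topologicalClosure_eq_top_iff,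
    Submodule.eq_bot_iff]
  intro f hf
  have hfK := f.2
  suffices h : (f : L2) = 0 from Subtype.ext h
  refine ext_fourierCoeff fun n => ?_
  rcases lt_or_ge n 0 with hn | hn
  · exact (isHardy_of_mem hfK).coeff n hn
  obtain ⟨N, rfl⟩ := Int.eq_ofNat_of_zero_le hn
  obtain ⟨p, hpc, hpH, ha⟩ := exists_continuous_isHardy
    (w := fun t => fourier (N : ℤ) t * conj (Θ.bdry t))
    (memLp_bdd_mul (memLp_fourier _ _) (Θ.memLp_conj_bdry 2)) N fun n hn => by
      rw [fourierCoeff_fourier_mul (fun t => conj (Θ.bdry t)), fourierCoeff_conj,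
        Θ.bddBoundary.coeff_neg (by lia), map_zero]
  have hpm : MemLp p ∞ m :=
    hpc.memLp_of_hasCompactSupport (HasCompactSupport.of_compactSpace _)
  have hkH := (IsHardy.fourier_nonneg hn).sub (hpH.bdry_mul Θ)
  have hk := toLp_mem_modelSpace Θ hkH (ha.congr (by
    filter_upwards [Θ.conj_bdry_mul_bdry] with t h1
    linear_combination p t * h1))
  have hbd : MemLp (hkH.memLp.toLp _) ∞ m :=
    (memLp_congr_ae hkH.memLp.coeFn_toLp).2 ((memLp_fourier _ _).sub
      (MemLp.mul' (p := ∞) (q := ∞) (r := ∞) hpm (Θ.bddBoundary.memLp ∞)))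
  have h0 : inner ℂ (hkH.memLp.toLp _) (f : L2) = 0 :=
    (Submodule.mem_orthogonal _ _).1 hf ⟨_, hk⟩ hbd
  have h1 := hpH.integral_conj_mul_anti (isAntiHardy_of_mem hfK)
  rw [inner_eq_integral] at h0
  have h2 : fourierCoeff (f : L2) N = (∫ t, conj (hkH.memLp.toLp _ t) * (f : L2) t ∂m) +
      ∫ t, conj (p t) * (conj (Θ.bdry t) * (f : L2) t) ∂m := by
    rw [← integral_add (integrable_conj_mul (Lp.memLp _) (Lp.memLp (f : L2)))
      (integrable_conj_mul hpH.memLp (isAntiHardy_of_mem hfK).memLp), fourierCoeff]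
    refine integral_congr_ae ?_
    filter_upwards [hkH.memLp.coeFn_toLp] with t h2
    rw [h2, smul_eq_mul, fourier_neg, map_sub, map_mul]
    ring
  rw [h2, h0, h1, add_zero]

/-! ### Norms of reproducing kernels -/

lemma bddBoundary_cauchy {l : ℂ} (hl : l ∈ Disc) : BddBoundary (fun z => (1 - conj l * z)⁻¹)
    (fun t => (1 - conj l * (AddCircle.toCircle t : ℂ))⁻¹) :=
  BddBoundary.of_continuousOn
    (DifferentiableOn.inv (by fun_prop) fun z hz =>
      one_sub_ne_zero hl (by simpa using (ball_subset_closedBall hz)))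
    (ContinuousOn.inv₀ (by fun_prop) fun z hz => one_sub_ne_zero hl (by simpa using hz))

lemma conj_toCircle_mul_self (t : Circ) :
    conj (AddCircle.toCircle t : ℂ) * (AddCircle.toCircle t : ℂ) = 1 := by
  rw [← Complex.normSq_eq_conj_mul_self, Complex.normSq_eq_norm_sq, Circle.norm_coe]
  norm_num

lemma toCircle_sub_ne_zero {l : ℂ} (hl : l ∈ Disc) (t : Circ) :
    (AddCircle.toCircle t : ℂ) - l ≠ 0 := by
  intro h
  have h1 : ‖l‖ < 1 := by simpa using hl
  rw [← sub_eq_zero.1 h, Circle.norm_coe] at h1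
  exact lt_irrefl _ h1

lemma conj_inv_one_sub {l : ℂ} (hl : l ∈ Disc) (t : Circ) :
    conj ((1 - conj l * (AddCircle.toCircle t : ℂ))⁻¹) =
      AddCircle.toCircle t / ((AddCircle.toCircle t : ℂ) - l) := by
  have h1 := conj_toCircle_mul_self t
  have h2 := toCircle_sub_ne_zero hl t
  have h3 : (1 - l * conj (AddCircle.toCircle t : ℂ)) ≠ 0 := by
    intro h
    apply h2
    linear_combination (AddCircle.toCircle t : ℂ) * h + l * h1
  rw [map_inv₀, map_sub, map_one, map_mul, Complex.conj_conj, inv_eq_one_div,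
    div_eq_div_iff h3 h2]
  linear_combination l * h1

/-- The reproducing property of the kernels, for bounded functions. -/
lemma inner_kernelL2 (l : Disc) {F : ℂ → ℂ} {f : L2} (hF : BddBoundary F f)
    (hf : f ∈ modelSpace Θ) : inner ℂ (kernelL2 Θ l) f = F l := by
  have hc := bddBoundary_cauchy l.2
  have h1 : ∫ t, fourier 1 t * ((f t - F l) / ((AddCircle.toCircle t : ℂ) - l)) ∂m = 0 := by
    simpa using ((BddBoundary.monomial 1).mul (hF.dslope l.2)).integral
  have h2 : ∫ t, conj ((1 - conj (l : ℂ) * (AddCircle.toCircle t : ℂ))⁻¹) ∂m = 1 := by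
    rw [integral_conj, hc.integral]
    simp
  have h3 := hc.isHardy.integral_conj_mul_anti (isAntiHardy_of_mem hf)
  have i1 : Integrable (fun t => fourier 1 t * ((f t - F l) / ((AddCircle.toCircle t : ℂ) - l))) m :=
    integrable_of_memLp (memLp_bdd_mul (memLp_fourier 1 _) ((hF.dslope l.2).memLp 2))
  have i2 := (integrable_of_memLp (memLp_conj (hc.memLp 2))).const_mul (F l)
  have i3 := (integrable_conj_mul (hc.memLp 2) (isAntiHardy_of_mem hf).memLp).const_mul (Θ.toFun l)
  -- Writing `c` for the Cauchy kernel at `λ`, `conj k_λ f` equals `z (f - F λ) / (z - λ) + F λ conj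
  -- c - Θ λ conj c (conj Θ f)`. The three terms have means `0`, `F λ` and `0`; the last uses `f ∈
  -- K_Θ`.
  have : F l = ∫ t, (fourier 1 t * ((f t - F l) / ((AddCircle.toCircle t : ℂ) - l)) +
      F l * conj ((1 - conj (l : ℂ) * (AddCircle.toCircle t : ℂ))⁻¹)) -
      Θ.toFun l * (conj ((1 - conj (l : ℂ) * (AddCircle.toCircle t : ℂ))⁻¹) *
        (conj (Θ.bdry t) * f t)) ∂m := by
    rw [integral_sub ?_ i3, integral_add i1 i2, integral_const_mul, integral_const_mul,
      h1, h2, h3]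
    · ring
    · exact i1.add i2
  rw [this, inner_eq_integral]
  refine integral_congr_ae ?_
  filter_upwards [((kernel_bddBoundary Θ l.2).memLp 2).coeFn_toLp] with t h4
  have h5 : conj (kernelL2 Θ l t) = (1 - Θ.toFun l * conj (Θ.bdry t)) *
      (AddCircle.toCircle t / ((AddCircle.toCircle t : ℂ) - l)) := by
    rw [← conj_inv_one_sub l.2, kernelL2, h4, kernelFun, div_eq_mul_inv, map_mul, map_sub,
      map_one, map_mul, Complex.conj_conj]
  rw [h5, conj_inv_one_sub l.2, fourier_one]
  have := toCircle_sub_ne_zero l.2 t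
  field_simp
  ring

/-- The reproducing property is applied to the kernel itself, whose value at `λ` is `(1 - |Θ λ|²) /
(1 - |λ|²)`. -/
lemma norm_kernelL2_sq (l : Disc) :
    ‖kernelL2 Θ l‖ ^ 2 * (1 - ‖(l : ℂ)‖ ^ 2) = 1 - ‖Θ.toFun l‖ ^ 2 := by
  have hk := kernel_bddBoundary Θ l.2
  have hk' : BddBoundary _ (kernelL2 Θ l) := ⟨hk.diff, hk.bdd, by
    filter_upwards [hk.lim, (hk.memLp 2).coeFn_toLp] with t h1 h2
    rw [kernelL2, h2]
    exact h1⟩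
  have h := inner_kernelL2 Θ l hk' (kernelL2_mem Θ l)
  rw [inner_self_eq_norm_sq_to_K, Complex.conj_mul', Complex.conj_mul'] at h
  have hl : ‖(l : ℂ)‖ < 1 := mem_ball_zero_iff.1 l.2
  have h0 : (1 : ℂ) - (‖(l : ℂ)‖ : ℂ) ^ 2 ≠ 0 := by
    have : (1 : ℝ) - ‖(l : ℂ)‖ ^ 2 ≠ 0 := by nlinarith [norm_nonneg (l : ℂ)]
    exact_mod_cast this
  rw [← div_eq_mul_inv, eq_div_iff h0] at h
  refine Complex.ofReal_injective ?_
  push_cast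
  exact h

lemma one_sub_norm_sq_pos (l : Disc) : 0 < 1 - ‖(l : ℂ)‖ ^ 2 := by
  have hl : ‖(l : ℂ)‖ < 1 := mem_ball_zero_iff.1 l.2
  nlinarith [norm_nonneg (l : ℂ)]

/-- The bound on the disc follows from nonnegativity of the squared kernel norm. -/
lemma InnerFunction.norm_le_one (l : Disc) : ‖Θ.toFun l‖ ≤ 1 := by
  have h := norm_kernelL2_sq Θ l
  have h1 : 0 ≤ ‖kernelL2 Θ l‖ ^ 2 * (1 - ‖(l : ℂ)‖ ^ 2) :=
    mul_nonneg (sq_nonneg _) (one_sub_norm_sq_pos l).le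
  nlinarith [norm_nonneg (Θ.toFun l)]

variable {Θ} in
lemma InnerFunction.Nonconstant.norm_lt_one (hΘ : Θ.Nonconstant) (l : Disc) :
    ‖Θ.toFun l‖ < 1 := by
  refine (Θ.norm_le_one l).lt_of_ne fun h => hΘ ⟨Θ.toFun l, ?_⟩
  exact Complex.eqOn_of_isPreconnected_of_isMaxOn_norm (convex_ball _ _).isPreconnected
    isOpen_ball Θ.analytic l.2 fun z hz => by
      simpa [h] using Θ.norm_le_one ⟨z, hz⟩

lemma norm_normKernel_le_one (l : Disc) : ‖(normKernel Θ l : modelSpace Θ)‖ ≤ 1 := by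
  have h := norm_kernelL2_sq Θ l
  have h1 : ‖(normKernel Θ l : modelSpace Θ)‖ =
      Real.sqrt ((1 - ‖(l : ℂ)‖ ^ 2) / (1 - ‖Θ.toFun l‖ ^ 2)) * ‖kernelL2 Θ l‖ := by
    have : ‖(normKernel Θ l : modelSpace Θ)‖ =
      ‖((Real.sqrt ((1 - ‖(l : ℂ)‖ ^ 2) / (1 - ‖Θ.toFun l‖ ^ 2)) : ℝ) : ℂ)‖ * ‖kernelL2 Θ l‖ :=
      norm_smul _ _
    rw [this, Complex.norm_real, Real.norm_of_nonneg (Real.sqrt_nonneg _)]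
  have h2 := one_sub_norm_sq_pos l
  have h3 : 0 ≤ 1 - ‖Θ.toFun l‖ ^ 2 := h ▸ mul_nonneg (sq_nonneg _) h2.le
  refine (sq_le_one_iff₀ (norm_nonneg _)).1 ?_
  rw [h1, mul_pow, Real.sq_sqrt (div_nonneg h2.le h3), div_mul_eq_mul_div, mul_comm, h]
  -- This also covers `|Θ λ| = 1`, where the quotient is `0 / 0 = 0`; hence an inequality and no
  -- condition on `Θ`.
  exact div_self_le_one _

end TruncToep

end

noncomputable section

namespace TruncToep

/-! ### Reconstruction of a symbol from the action on two kernels -/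

variable (Θ : InnerFunction)

/-- Multiplication by a bounded function on `L²`. -/
def mulOp (u : Circ → ℂ) (hu : MemLp u ∞ m) : L2 →L[ℂ] L2 :=
  (ContinuousLinearMap.mul ℂ ℂ).holderL m ∞ 2 2 (hu.toLp u)

lemma coeFn_mulOp (u : Circ → ℂ) (hu : MemLp u ∞ m) (f : L2) :
    mulOp u hu f =ᵐ[m] fun t => u t * f t := by
  have h := ContinuousLinearMap.coeFn_holder (r := 2) (ContinuousLinearMap.mul ℂ ℂ)
    (hu.toLp u) f
  filter_upwards [h, hu.coeFn_toLp] with t h1 h2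
  rw [← h2]
  exact h1

/-- The action of truncated Toeplitz operators on a fixed function, as a function of the symbol. -/
def ttoEval (f : bddModel Θ) : L2 →L[ℂ] modelSpace Θ := proj Θ ∘L mulOp _ f.2

lemma ttoEval_apply (f : bddModel Θ) (φ : L2) : ttoEval Θ f φ = tto Θ φ f := by
  refine congrArg (proj Θ) (Lp.ext ?_)
  filter_upwards [coeFn_mulOp _ f.2 φ, (memLp_symbol_mul Θ φ f).coeFn_toLp] with t h1 h2
  refine h1.trans ?_
  rw [h2, mul_comm]

/-- The constant function one. -/
def oneL2 : L2 := (memLp_fourier 0 2).toLp _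

lemma coeFn_oneL2 : oneL2 =ᵐ[m] fun _ => 1 := by
  filter_upwards [(memLp_fourier 0 2).coeFn_toLp] with t h
  rw [oneL2, h, fourier_zero]

lemma isAntiHardy_zero : IsAntiHardy 0 :=
  ⟨MemLp.zero, fun n _ => by simp [fourierCoeff]⟩

lemma isHardy_zero : IsHardy 0 :=
  ⟨MemLp.zero, fun n _ => by simp [fourierCoeff]⟩

lemma tto_oneL2 (f : bddModel Θ) : tto Θ oneL2 f = f := by
  refine tto_apply_eq Θ (f : modelSpace Θ).2 isHardy_zero isAntiHardy_zero ?_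
  filter_upwards [coeFn_oneL2] with t h
  rw [h]
  simp

/-- The reproducing kernel as an element of `K_Θ ∩ H^∞`. -/
def kernelBdd (l : Disc) : bddModel Θ :=
  ⟨⟨kernelL2 Θ l, kernelL2_mem Θ l⟩,
    (memLp_congr_ae ((kernel_bddBoundary Θ l.2).memLp 2).coeFn_toLp).2
      ((kernel_bddBoundary Θ l.2).memLp ∞)⟩

lemma normKernel_eq_smul (l : Disc) : normKernel Θ l =
    ((Real.sqrt ((1 - ‖(l : ℂ)‖ ^ 2) / (1 - ‖Θ.toFun l‖ ^ 2)) : ℝ) : ℂ) • kernelBdd Θ l := rfl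

lemma isHardy_one_sub (l : ℂ) : IsHardy fun t => 1 - l * fourier 1 t :=
  ((IsHardy.fourier_nonneg le_rfl).sub ((IsHardy.fourier_nonneg zero_le_one).const_mul l)).congr
    (Eventually.of_forall fun t => by simp only [fourier_zero])

lemma memLp_one_sub (l : ℂ) (p : ℝ≥0∞) : MemLp (fun t : Circ => 1 - l * fourier 1 t) p m :=
  (by fun_prop : Continuous fun t : Circ => 1 - l * fourier 1 t).memLp_of_hasCompactSupport
    (HasCompactSupport.of_compactSpace _)

/-- The basic relation between the symbol and the action on a kernel. -/
lemma exists_kernel_relation (φ : L2) (l : Disc) : ∃ h g, IsHardy h ∧ IsHardy g ∧ ∀ᵐ t ∂m,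
    φ t * (1 - conj (Θ.toFun l) * Θ.bdry t) =
      (1 - conj (l : ℂ) * fourier 1 t) * (tto Θ φ (kernelBdd Θ l) : L2) t
        + Θ.bdry t * h t + conj (g t) := by
  obtain ⟨h, a, hh, ha, e⟩ := exists_tto_decomposition Θ φ (kernelBdd Θ l)
  -- Multiplying by `1 - conj λ z` clears the denominator of the kernel.
  obtain ⟨g, hg, hga⟩ := ha.exists_isHardy (conj (l : ℂ))
  refine ⟨_, g, hh.mul' (memLp_one_sub (conj (l : ℂ)) ∞) (isHardy_one_sub _), hg, ?_⟩
  filter_upwards [e, ((kernel_bddBoundary Θ l.2).memLp 2).coeFn_toLp] with t h1 h2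
  rw [← hga]
  have h3 : ((kernelBdd Θ l : modelSpace Θ) : L2) t = kernelFun Θ l t := h2
  have h4 : (1 - conj (l : ℂ) * fourier 1 t) ≠ 0 := by
    rw [fourier_one]
    exact one_sub_ne_zero l.2 (Circle.norm_coe _).le
  have h5 : (1 - conj (l : ℂ) * fourier 1 t) * kernelFun Θ l t =
      1 - conj (Θ.toFun l) * Θ.bdry t := by
    rw [kernelFun, ← fourier_one, mul_div_cancel₀ _ h4]
  rw [h3] at h1
  linear_combination (1 - conj (l : ℂ) * fourier 1 t) * h1 - φ t * h5

/-- Projecting `conj g` to `H²` leaves only its mean, which is the constant `c`. -/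
lemma exists_starProjection_H2 {x : L2} {f g : Circ → ℂ} (hf : IsHardy f) (hg : IsHardy g)
    (e : x =ᵐ[m] fun t => f t + conj (g t)) :
    ∃ c : ℂ, H2.starProjection x =ᵐ[m] fun t => f t + c := by
  set c := conj (fourierCoeff g 0)
  have hc : IsHardy fun t => c * fourier 0 t := (IsHardy.fourier_nonneg le_rfl).const_mul c
  have h1 := hf.add hc
  have h2 : IsAntiHardy fun t => conj (g t) - c * fourier 0 t := by
    refine ⟨(memLp_conj hg.memLp).sub hc.memLp, fun n hn => ?_⟩
    rw [fourierCoeff_sub (memLp_conj hg.memLp) hc.memLp, fourierCoeff_conj, fourierCoeff.const_mul,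
      fourierCoeff_fourier, Pi.single_apply]
    rcases hn.eq_or_lt with rfl | hn
    · simp [c]
    · rw [hg.coeff _ (by lia), if_neg hn.ne']
      simp
  refine ⟨c, ?_⟩
  rw [Submodule.eq_starProjection_of_mem_orthogonal' (u := x) h1.toLp_mem
    (h2.congr h2.memLp.coeFn_toLp.symm).mem_orthogonal ?_]
  · filter_upwards [h1.memLp.coeFn_toLp] with t h3
    rw [h3, fourier_zero, mul_one]
  · refine Lp.ext ?_
    filter_upwards [e, h1.memLp.coeFn_toLp, h2.memLp.coeFn_toLp,
      Lp.coeFn_add (h1.memLp.toLp _) (h2.memLp.toLp _)] with t h3 h4 h5 h6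
    rw [h3, h6, Pi.add_apply, h4, h5]
    ring

/-- A symbol, modulo symbols of the zero operator and constants, in terms of the action on
two kernels. -/
lemma exists_symbol_mod_const {l l' : Disc} (hl : Θ.toFun l ≠ Θ.toFun l') :
    ∃ S : (modelSpace Θ × modelSpace Θ) →L[ℂ] L2, ∀ φ : L2, ∃ c : ℂ,
      tto Θ φ = tto Θ (S (tto Θ φ (kernelBdd Θ l), tto Θ φ (kernelBdd Θ l')) + c • oneL2) := by
  set a := Θ.toFun l
  set b := Θ.toFun l'
  set κ : ℂ := (conj b - conj a)⁻¹
  have hκ : κ * (conj b - conj a) = 1 := inv_mul_cancel₀ fun h =>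
    hl ((starRingEnd ℂ).injective (sub_eq_zero.1 h).symm)
  let D1 : (modelSpace Θ × modelSpace Θ) →L[ℂ] L2 :=
    mulOp _ (memLp_one_sub (conj (l : ℂ)) ∞) ∘L (modelSpace Θ).subtypeL ∘L
      ContinuousLinearMap.fst ℂ _ _
  let D2 : (modelSpace Θ × modelSpace Θ) →L[ℂ] L2 :=
    mulOp _ (memLp_one_sub (conj (l' : ℂ)) ∞) ∘L (modelSpace Θ).subtypeL ∘L
      ContinuousLinearMap.snd ℂ _ _
  -- The two kernel relations are linear in `φ` and `φ Θ`. Eliminating `φ Θ` gives `φ = E + Θ H' +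
  -- conj G'`; eliminating `φ` and multiplying by `conj Θ` gives `φ = F + H + conj (Θ G)`, with all
  -- four functions in `H²`.
  let E := κ • (conj b • D1 - conj a • D2)
  let F := κ • mulOp _ (Θ.memLp_conj_bdry ∞) ∘L (D1 - D2)
  refine ⟨F + H2.starProjection ∘L (E - F), fun φ => ?_⟩
  obtain ⟨h1, g1, hh1, hg1, e1⟩ := exists_kernel_relation Θ φ l
  obtain ⟨h2, g2, hh2, hg2, e2⟩ := exists_kernel_relation Θ φ l'
  set x : modelSpace Θ × modelSpace Θ := (tto Θ φ (kernelBdd Θ l), tto Θ φ (kernelBdd Θ l'))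
  have eE : E x =ᵐ[m] fun t => κ * (conj b * ((1 - conj (l : ℂ) * fourier 1 t) * (x.1 : L2) t)
      - conj a * ((1 - conj (l' : ℂ) * fourier 1 t) * (x.2 : L2) t)) := by
    filter_upwards [Lp.coeFn_smul κ (conj b • D1 x - conj a • D2 x),
      Lp.coeFn_sub (conj b • D1 x) (conj a • D2 x), Lp.coeFn_smul (conj b) (D1 x),
      Lp.coeFn_smul (conj a) (D2 x), coeFn_mulOp _ (memLp_one_sub (conj (l : ℂ)) ∞) x.1,
      coeFn_mulOp _ (memLp_one_sub (conj (l' : ℂ)) ∞) x.2] with t j1 j2 j3 j4 j5 j6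
    refine j1.trans ?_
    rw [Pi.smul_apply, j2, Pi.sub_apply, j3, j4, Pi.smul_apply, Pi.smul_apply, ← j5, ← j6]
    rfl
  have eF : F x =ᵐ[m] fun t => κ * (conj (Θ.bdry t) *
      ((1 - conj (l : ℂ) * fourier 1 t) * (x.1 : L2) t
      - (1 - conj (l' : ℂ) * fourier 1 t) * (x.2 : L2) t)) := by
    filter_upwards [Lp.coeFn_smul κ (mulOp _ (Θ.memLp_conj_bdry ∞) (D1 x - D2 x)),
      coeFn_mulOp _ (Θ.memLp_conj_bdry ∞) (D1 x - D2 x),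
      Lp.coeFn_sub (D1 x) (D2 x), coeFn_mulOp _ (memLp_one_sub (conj (l : ℂ)) ∞) x.1,
      coeFn_mulOp _ (memLp_one_sub (conj (l' : ℂ)) ∞) x.2] with t j1 j2 j3 j5 j6
    refine j1.trans ?_
    rw [Pi.smul_apply, j2, j3, Pi.sub_apply, ← j5, ← j6]
    rfl
  have hH : IsHardy fun t => κ * (h1 t - h2 t) := (hh1.sub hh2).const_mul κ
  have hG : IsHardy fun t => conj κ * (g1 t - g2 t) := (hg1.sub hg2).const_mul _
  have hH' : IsHardy fun t => κ * (conj b * h1 t - conj a * h2 t) :=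
    ((hh1.const_mul _).sub (hh2.const_mul _)).const_mul κ
  have hG' : IsHardy fun t => conj κ * (b * g1 t - a * g2 t) :=
    ((hg1.const_mul _).sub (hg2.const_mul _)).const_mul _
  have eφF : φ =ᵐ[m] fun t => F x t + κ * (h1 t - h2 t)
      + conj (Θ.bdry t * (conj κ * (g1 t - g2 t))) := by
    filter_upwards [e1, e2, eF, Θ.conj_bdry_mul_bdry] with t j1 j2 j3 j4
    rw [j3]
    simp only [map_mul, map_sub, Complex.conj_conj]
    linear_combination κ * conj (Θ.bdry t) * (j1 - j2) - φ t * conj (Θ.bdry t) * Θ.bdry t * hκ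
      - (φ t - κ * (h1 t - h2 t)) * j4
  have eφE : φ =ᵐ[m] fun t => E x t + Θ.bdry t * (κ * (conj b * h1 t - conj a * h2 t))
      + conj (conj κ * (b * g1 t - a * g2 t)) := by
    filter_upwards [e1, e2, eE] with t j1 j2 j3
    rw [j3]
    simp only [map_mul, map_sub, Complex.conj_conj]
    linear_combination κ * (conj b * j1 - conj a * j2) - φ t * hκ
  -- Here `E - F = H - Θ H' + conj (Θ G - G')`, so its projection to `H²` is `H - Θ H' + c`. Hence
  -- `F` plus this projection minus `c` differs from `φ` by `Θ H' + conj (Θ G)`, a symbol of the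
  -- zero operator.
  obtain ⟨c, hc⟩ := exists_starProjection_H2 (x := E x - F x) (hH.sub (hH'.bdry_mul Θ))
    ((hG.bdry_mul Θ).sub hG') (by
      filter_upwards [eφF, eφE, Lp.coeFn_sub (E x) (F x)] with t j1 j2 j3
      rw [j3, Pi.sub_apply, map_sub]
      linear_combination j1 - j2)
  refine ⟨-c, ?_⟩
  rw [← sub_eq_zero, ← tto_sub]
  refine tto_eq_zero Θ hH' hG ?_
  filter_upwards [eφF, hc, coeFn_oneL2, Lp.coeFn_smul (-c) oneL2,
    Lp.coeFn_add (F x) (H2.starProjection (E x - F x)),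
    Lp.coeFn_add (F x + H2.starProjection (E x - F x)) (-c • oneL2),
    Lp.coeFn_sub φ (F x + H2.starProjection (E x - F x) + -c • oneL2)]
    with t j1 j2 j3 j4 j5 j6 j7
  refine j7.trans ?_
  rw [Pi.sub_apply, j6, Pi.add_apply, j5, Pi.add_apply, j4, Pi.smul_apply, j3, j2, smul_eq_mul]
  linear_combination j1

variable {Θ} in
lemma InnerFunction.Nonconstant.kernelBdd_ne_zero (hΘ : Θ.Nonconstant) (l : Disc) :
    (kernelBdd Θ l : modelSpace Θ) ≠ 0 := by
  intro h
  have h0 : kernelL2 Θ l = 0 := congrArg Subtype.val h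
  have h1 := norm_kernelL2_sq Θ l
  have h2 := hΘ.norm_lt_one l
  rw [h0, norm_zero] at h1
  nlinarith [norm_nonneg (Θ.toFun l)]

variable {Θ} in
/-- A symbol of a truncated Toeplitz operator can be recovered continuously from the action of the
operator on two suitable reproducing kernels. -/
theorem exists_symbol (hΘ : Θ.Nonconstant) :
    ∃ (l l' : Disc) (R : (modelSpace Θ × modelSpace Θ) →L[ℂ] L2), ∀ φ : L2,
      tto Θ (R (tto Θ φ (kernelBdd Θ l), tto Θ φ (kernelBdd Θ l'))) = tto Θ φ := by
  obtain ⟨l, l', hl⟩ : ∃ l l' : Disc, Θ.toFun l ≠ Θ.toFun l' := by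
    by_contra! h
    exact hΘ ⟨Θ.toFun 0, fun z hz => h ⟨z, hz⟩ ⟨0, mem_ball_self one_pos⟩⟩
  obtain ⟨S, hS⟩ := exists_symbol_mod_const Θ hl
  set k : modelSpace Θ := (kernelBdd Θ l).1
  have hk0 : inner ℂ k k ≠ 0 := inner_self_ne_zero.2 (hΘ.kernelBdd_ne_zero l)
  -- The missing constant is read off at one kernel: the symbol `1` acts as the identity, so `A_φ k
  -- - A_{S x} k = c k`, and pairing with `k` isolates `c`.
  let γ : (modelSpace Θ × modelSpace Θ) →L[ℂ] ℂ := (inner ℂ k k)⁻¹ • (innerSL ℂ k) ∘L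
    (ContinuousLinearMap.fst ℂ _ _ - ttoEval Θ (kernelBdd Θ l) ∘L S)
  refine ⟨l, l', S + γ.smulRight oneL2, fun φ => ?_⟩
  obtain ⟨c, hc⟩ := hS φ
  set x : modelSpace Θ × modelSpace Θ := (tto Θ φ (kernelBdd Θ l), tto Θ φ (kernelBdd Θ l'))
  have hγ : γ x = c := by
    have h1 : x.1 - ttoEval Θ (kernelBdd Θ l) (S x) = c • k := by
      have : x.1 = tto Θ φ (kernelBdd Θ l) := rfl
      rw [this, hc, ttoEval_apply, tto_add, tto_smul, LinearMap.add_apply, add_sub_cancel_left,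
        LinearMap.smul_apply, tto_oneL2]
    have h2 : γ x = (inner ℂ k k)⁻¹ * inner ℂ k (x.1 - ttoEval Θ (kernelBdd Θ l) (S x)) := rfl
    have h3 : inner ℂ k (c • k) = c * inner ℂ k k := inner_smul_right k k c
    rw [h2, h1, h3, mul_comm c, inv_mul_cancel_left₀ hk0]
  rw [hc]
  congr 1
  change S x + γ x • oneL2 = _
  rw [hγ]

end TruncToep

end

noncomputable section

namespace TruncToep

/-! ### The reproducing kernel thesis implies uniform estimates -/

variable {Θ : InnerFunction}

lemma norm_le_rhoR {T : bddModel Θ →ₗ[ℂ] modelSpace Θ} (hT : rhoR Θ T < ∞) (l : Disc) :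
    ‖T (normKernel Θ l)‖ ≤ (rhoR Θ T).toReal := by
  rw [← toReal_enorm]
  exact ENNReal.toReal_mono hT.ne (le_iSup (fun l => ‖T (normKernel Θ l)‖ₑ) l)

lemma rhoR_le {T : bddModel Θ →ₗ[ℂ] modelSpace Θ} {C : ℝ}
    (h : ∀ l, ‖T (normKernel Θ l)‖ ≤ C) : rhoR Θ T ≤ ENNReal.ofReal C :=
  iSup_le fun l => by
    rw [← ofReal_norm]
    exact ENNReal.ofReal_le_ofReal (h l)

lemma rhoR_restr_le (A : modelSpace Θ →L[ℂ] modelSpace Θ) : rhoR Θ (restr Θ A) ≤ ‖A‖ₑ := by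
  rw [← ofReal_norm]
  refine rhoR_le fun l => (A.le_opNorm _).trans ?_
  exact mul_le_of_le_one_right (norm_nonneg A) (norm_normKernel_le_one Θ l)

/-- The family of the values of an operator on the normalised kernels. -/
def orbit (T : bddModel Θ →ₗ[ℂ] modelSpace Θ) (hT : rhoR Θ T < ∞) :
    lp (fun _ : Disc => modelSpace Θ) ∞ :=
  ⟨fun l => T (normKernel Θ l), memℓp_infty ⟨(rhoR Θ T).toReal, by
    rintro _ ⟨l, rfl⟩
    exact norm_le_rhoR hT l⟩⟩

lemma norm_orbit_le (T : bddModel Θ →ₗ[ℂ] modelSpace Θ) (hT : rhoR Θ T < ∞) :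
    ‖orbit T hT‖ ≤ (rhoR Θ T).toReal :=
  lp.norm_le_of_forall_le ENNReal.toReal_nonneg (norm_le_rhoR hT)

lemma InnerFunction.Nonconstant.exists_smul_normKernel (hΘ : Θ.Nonconstant) (l : Disc) :
    ∃ s : ℂ, kernelBdd Θ l = s • normKernel Θ l := by
  have h1 := one_sub_norm_sq_pos l
  have h2 : 0 < 1 - ‖Θ.toFun l‖ ^ 2 := by
    nlinarith [hΘ.norm_lt_one l, norm_nonneg (Θ.toFun l)]
  refine ⟨(((Real.sqrt ((1 - ‖(l : ℂ)‖ ^ 2) / (1 - ‖Θ.toFun l‖ ^ 2)) : ℝ) : ℂ))⁻¹, ?_⟩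
  rw [normKernel_eq_smul, inv_smul_smul₀]
  exact_mod_cast (Real.sqrt_pos.2 (div_pos h1 h2)).ne'

/-- A symbol can be recovered continuously from the values on the normalised kernels. -/
lemma exists_symbol_of_orbit (hΘ : Θ.Nonconstant) :
    ∃ S : lp (fun _ : Disc => modelSpace Θ) ∞ →L[ℂ] L2, ∀ (φ : L2)
      (h : rhoR Θ (tto Θ φ) < ∞), tto Θ (S (orbit _ h)) = tto Θ φ := by
  obtain ⟨l, l', R, hR⟩ := exists_symbol hΘ
  obtain ⟨s, hs⟩ := hΘ.exists_smul_normKernel l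
  obtain ⟨s', hs'⟩ := hΘ.exists_smul_normKernel l'
  refine ⟨R ∘L ((s • lp.evalCLM ℂ (fun _ : Disc => modelSpace Θ) ∞ l).prod
    (s' • lp.evalCLM ℂ (fun _ : Disc => modelSpace Θ) ∞ l')), fun φ h => ?_⟩
  have hφ := hR φ
  rw [hs, hs', map_smul, map_smul] at hφ
  exact hφ

/-- The families `g` that consist of the values on the normalised kernels of the operator with
symbol `S g`. -/
def orbitSpace (S : lp (fun _ : Disc => modelSpace Θ) ∞ →L[ℂ] L2) :
    Submodule ℂ (lp (fun _ : Disc => modelSpace Θ) ∞) :=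
  ⨅ l : Disc, LinearMap.ker ((lp.evalCLM ℂ (fun _ : Disc => modelSpace Θ) ∞ l -
    ttoEval Θ (normKernel Θ l) ∘L S : _ →L[ℂ] _) : _ →ₗ[ℂ] modelSpace Θ)

lemma mem_orbitSpace {S : lp (fun _ : Disc => modelSpace Θ) ∞ →L[ℂ] L2}
    {g : lp (fun _ : Disc => modelSpace Θ) ∞} :
    g ∈ orbitSpace S ↔ ∀ l, tto Θ (S g) (normKernel Θ l) = g l := by
  simp only [orbitSpace, Submodule.mem_iInf, ← ttoEval_apply]
  exact forall_congr' fun l => sub_eq_zero.trans eq_comm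

/-- Each defining condition equates two continuous linear maps; continuity of `S` is essential here.
-/
lemma isClosed_orbitSpace (S : lp (fun _ : Disc => modelSpace Θ) ∞ →L[ℂ] L2) :
    IsClosed (orbitSpace S : Set (lp (fun _ : Disc => modelSpace Θ) ∞)) := by
  rw [orbitSpace, Submodule.coe_iInf]
  exact isClosed_iInter fun l => ContinuousLinearMap.isClosed_ker _

lemma rhoR_lt_top_of_mem {S : lp (fun _ : Disc => modelSpace Θ) ∞ →L[ℂ] L2}
    {g : lp (fun _ : Disc => modelSpace Θ) ∞} (hg : g ∈ orbitSpace S) :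
    rhoR Θ (tto Θ (S g)) < ∞ :=
  (rhoR_le (C := ‖g‖) fun l => by
    rw [mem_orbitSpace.1 hg]
    exact lp.norm_apply_le_norm ENNReal.top_ne_zero g l).trans_lt ENNReal.ofReal_lt_top

/-- If the reproducing kernel thesis holds for `Θ`, then it holds with a uniform constant. -/
theorem exists_uniform_bound (hΘ : Θ.Nonconstant)
    (H : ∀ φ : L2, rhoR Θ (tto Θ φ) < ∞ → IsBddOp Θ (tto Θ φ)) :
    ∃ M : ℝ, 0 < M ∧ ∀ φ : L2, rhoR Θ (tto Θ φ) < ∞ → ∀ f : bddModel Θ,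
      ‖tto Θ φ f‖ ≤ M * (rhoR Θ (tto Θ φ)).toReal * ‖(f : modelSpace Θ)‖ := by
  obtain ⟨S, hS⟩ := exists_symbol_of_orbit hΘ
  have : CompleteSpace (orbitSpace S) := (isClosed_orbitSpace S).completeSpace_coe
  -- For fixed bounded `f` the value `A_{S g} f` is continuous in `g`, even though the operator may
  -- be unbounded in `f`. For `f = 0` the inverse is `0`.
  let G (f : bddModel Θ) : orbitSpace S →L[ℂ] modelSpace Θ :=
    ((‖(f : modelSpace Θ)‖ : ℂ)⁻¹) • (ttoEval Θ f ∘L S ∘L (orbitSpace S).subtypeL)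
  have hG (f : bddModel Θ) (x : orbitSpace S) :
      ‖G f x‖ = ‖(f : modelSpace Θ)‖⁻¹ * ‖tto Θ (S x) f‖ := by
    have : G f x = ((‖(f : modelSpace Θ)‖ : ℂ)⁻¹) • tto Θ (S x) f := by
      rw [← ttoEval_apply]
      rfl
    rw [this, norm_smul, norm_inv, Complex.norm_real, norm_norm]
  obtain ⟨M, hM⟩ := banach_steinhaus (g := G) fun x => by
    obtain ⟨C, hC⟩ := H _ (rhoR_lt_top_of_mem x.2)
    refine ⟨|C|, fun f => ?_⟩
    rw [hG]
    calc _ ≤ ‖(f : modelSpace Θ)‖⁻¹ * (|C| * ‖(f : modelSpace Θ)‖) := by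
          gcongr
          exact (hC f).trans (by gcongr; exact le_abs_self C)
      _ = |C| * (‖(f : modelSpace Θ)‖⁻¹ * ‖(f : modelSpace Θ)‖) := by ring
      _ ≤ |C| := mul_le_of_le_one_right (abs_nonneg _) (inv_mul_le_one (a := ‖(f : modelSpace Θ)‖))
  refine ⟨|M| + 1, by positivity, fun φ hφ f => ?_⟩
  -- `S` need not return `φ` itself, but it returns a symbol of the same operator, which suffices.
  have hx : orbit _ hφ ∈ orbitSpace S := mem_orbitSpace.2 fun l => by rw [hS]; rfl
  have h1 := (G f).le_opNorm ⟨_, hx⟩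
  rw [hG, hS] at h1
  rcases eq_or_ne (f : modelSpace Θ) 0 with h0 | h0
  · have : f = 0 := Subtype.ext h0
    rw [this, map_zero, norm_zero]
    positivity
  · rw [inv_mul_le_iff₀ (norm_pos_iff.2 h0)] at h1
    refine h1.trans ?_
    rw [mul_comm]
    gcongr
    · exact (hM f).trans ((le_abs_self M).trans (by linarith))
    · exact norm_orbit_le _ hφ

/-! ### Bounded extensions, equivalence of norms and completeness -/

lemma IsBddOp.exists_restr_eq {T : bddModel Θ →ₗ[ℂ] modelSpace Θ} (hT : IsBddOp Θ T) :
    ∃ A : modelSpace Θ →L[ℂ] modelSpace Θ, restr Θ A = T := by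
  have hd : DenseRange (bddModel Θ).subtype := by
    rw [DenseRange, Submodule.coe_subtype, Subtype.range_coe]
    exact dense_bddModel Θ
  exact ⟨T.extendOfNorm (bddModel Θ).subtype,
    LinearMap.ext fun f => LinearMap.extendOfNorm_eq hd hT f⟩

lemma norm_le_of_restr {A : modelSpace Θ →L[ℂ] modelSpace Θ} {C : ℝ} (hC : 0 ≤ C)
    (h : ∀ f : bddModel Θ, ‖restr Θ A f‖ ≤ C * ‖(f : modelSpace Θ)‖) : ‖A‖ ≤ C := by
  refine A.opNorm_le_bound hC fun x => ?_
  have hc : IsClosed {x : modelSpace Θ | ‖A x‖ ≤ C * ‖x‖} :=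
    isClosed_le (by fun_prop) (by fun_prop)
  exact hc.closure_subset_iff.2 (fun f hf => h ⟨f, hf⟩) (dense_bddModel Θ x)

lemma rhoT_lt_top (A : bddTTO Θ) : rhoT Θ A < ∞ := (rhoR_restr_le A.1).trans_lt enorm_lt_top

/-- If the reproducing kernel thesis holds for `Θ`, then `ρ_r` is equivalent to the norm. -/
theorem exists_enorm_le (hΘ : Θ.Nonconstant)
    (H : ∀ φ : L2, rhoR Θ (tto Θ φ) < ∞ → IsBddOp Θ (tto Θ φ)) :
    ∃ M : ℝ, 0 < M ∧ ∀ A : bddTTO Θ,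
      rhoT Θ A ≤ ‖A‖ₑ ∧ ‖A‖ₑ ≤ ENNReal.ofReal M * rhoT Θ A := by
  obtain ⟨M, hM0, hM⟩ := exists_uniform_bound hΘ H
  refine ⟨M, hM0, fun A => ⟨rhoR_restr_le A.1, ?_⟩⟩
  obtain ⟨φ, hφ⟩ := A.2
  have hA := rhoT_lt_top A
  have h1 : ‖A.1‖ ≤ M * (rhoT Θ A).toReal := by
    refine norm_le_of_restr (by positivity) fun f => ?_
    rw [rhoT, hφ] at hA ⊢
    exact hM φ hA f
  rw [← ENNReal.ofReal_toReal hA.ne, ← ENNReal.ofReal_mul hM0.le, ← ofReal_norm]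
  exact ENNReal.ofReal_le_ofReal h1

/-- If the reproducing kernel thesis holds for `Θ`, then `𝒯(K_Θ)` is complete for `ρ_r`. -/
theorem exists_tendsto_rhoT (hΘ : Θ.Nonconstant)
    (H : ∀ φ : L2, rhoR Θ (tto Θ φ) < ∞ → IsBddOp Θ (tto Θ φ)) (A : ℕ → bddTTO Θ)
    (hA : ∀ ε : ℝ≥0∞, 0 < ε → ∃ N : ℕ, ∀ i ≥ N, ∀ j ≥ N, rhoT Θ (A i - A j) < ε) :
    ∃ B : bddTTO Θ, Tendsto (fun n => rhoT Θ (A n - B)) atTop (𝓝 0) := by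
  obtain ⟨S, hS⟩ := exists_symbol_of_orbit hΘ
  let o (n : ℕ) : lp (fun _ : Disc => modelSpace Θ) ∞ := orbit _ (rhoT_lt_top (A n))
  have ho (n : ℕ) : o n ∈ orbitSpace S := mem_orbitSpace.2 fun l => by
    obtain ⟨φ, hφ⟩ := (A n).2
    have h1 : rhoR Θ (tto Θ φ) < ∞ := hφ ▸ rhoT_lt_top (A n)
    have h2 : o n = orbit _ h1 := by
      simp only [o, hφ]
    rw [h2, hS]
    rfl
  have hsub (i j : ℕ) : ‖o i - o j‖ ≤ (rhoT Θ (A i - A j)).toReal :=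
    norm_orbit_le _ (rhoT_lt_top (A i - A j))
  have hc : CauchySeq o := by
    refine Metric.cauchySeq_iff.2 fun ε hε => ?_
    obtain ⟨N, hN⟩ := hA (ENNReal.ofReal ε) (ENNReal.ofReal_pos.2 hε)
    refine ⟨N, fun i hi j hj => ?_⟩
    rw [dist_eq_norm]
    refine (hsub i j).trans_lt ?_
    exact (ENNReal.lt_ofReal_iff_toReal_lt (rhoT_lt_top _).ne).1 (hN i hi j hj)
  obtain ⟨g, hg⟩ := cauchySeq_tendsto_of_complete hc
  have hgS : g ∈ orbitSpace S :=
    (isClosed_orbitSpace S).mem_of_tendsto hg (Eventually.of_forall ho)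
  -- The limit operator has symbol `S g`; the kernel thesis is used only to make it bounded.
  obtain ⟨B, hB⟩ := (H _ (rhoR_lt_top_of_mem hgS)).exists_restr_eq
  refine ⟨⟨B, _, hB⟩, ?_⟩
  have h1 : Tendsto (fun n => ENNReal.ofReal ‖o n - g‖) atTop (𝓝 0) := by
    have := ENNReal.tendsto_ofReal (tendsto_iff_norm_sub_tendsto_zero.1 hg)
    rwa [ENNReal.ofReal_zero] at this
  refine tendsto_of_tendsto_of_tendsto_of_le_of_le tendsto_const_nhds h1
    (fun n => zero_le) fun n => rhoR_le fun l => ?_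
  have h2 : restr Θ ((A n - ⟨B, _, hB⟩ : bddTTO Θ) : modelSpace Θ →L[ℂ] modelSpace Θ)
      (normKernel Θ l) = (o n - g) l := by
    have h3 : restr Θ B (normKernel Θ l) = g l := by rw [hB, mem_orbitSpace.1 hgS]
    change restr Θ (A n).1 (normKernel Θ l) - restr Θ B (normKernel Θ l) = o n l - g l
    rw [h3]
    rfl
  rw [h2]
  exact lp.norm_apply_le_norm ENNReal.top_ne_zero _ l

end TruncToep

end

noncomputable section

namespace TruncToep

/-! ### Roots of singular inner functions -/

/-- A primitive `g` of `F' / F` with `g 0 = log (F 0)` works, since `F exp (-g)` has zero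
derivative. -/
lemma exists_exp_eq {F : ℂ → ℂ} (hF : DifferentiableOn ℂ F Disc) (h0 : ∀ z ∈ Disc, F z ≠ 0) :
    ∃ g : ℂ → ℂ, DifferentiableOn ℂ g Disc ∧ ∀ z ∈ Disc, Complex.exp (g z) = F z := by
  have hd : DifferentiableOn ℂ (fun z => deriv F z / F z) Disc := (hF.deriv isOpen_ball).div hF h0
  obtain ⟨g, hg0, hg⟩ := hd.isExactOn_ball.with_val_at 0 (Complex.log (F 0))
  have hgd : DifferentiableOn ℂ g Disc := fun z hz =>
    (hg z hz).differentiableAt.differentiableWithinAt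
  refine ⟨g, hgd, fun z hz => ?_⟩
  have hder (w : ℂ) (hw : w ∈ Disc) :
      HasDerivAt (fun z => F z * Complex.exp (-g z)) 0 w := by
    have hFw := (hF.differentiableAt (isOpen_ball.mem_nhds hw)).hasDerivAt
    refine (hFw.mul (hg w hw).neg.cexp).congr_deriv ?_
    have := mul_div_cancel₀ (deriv F w) (h0 w hw)
    linear_combination (-Complex.exp (-g w)) * this
  have h1 : F z * Complex.exp (-g z) = F 0 * Complex.exp (-g 0) := by
    refine isOpen_ball.is_const_of_deriv_eq_zero (convex_ball _ _).isPreconnected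
      (fun w hw => (hder w hw).differentiableAt.differentiableWithinAt)
      (fun w hw => (hder w hw).deriv) hz (mem_ball_self one_pos)
  rw [hg0, Complex.exp_neg, Complex.exp_neg, Complex.exp_log (h0 0 (mem_ball_self one_pos)),
    mul_inv_cancel₀ (h0 0 (mem_ball_self one_pos)), mul_inv_eq_one₀ (Complex.exp_ne_zero _)] at h1
  exact h1.symm

/-- If a power of a continuous function has a nonzero one-sided limit, so has the function. -/
lemma exists_tendsto_of_pow {c : ℝ → ℂ} (hc : ContinuousOn c (Ioo 0 1)) {n : ℕ} (hn : n ≠ 0)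
    {w : ℂ} (hw : w ≠ 0) (h : Tendsto (fun r => c r ^ n) (𝓝[<] 1) (𝓝 w)) :
    ∃ y, y ^ n = w ∧ Tendsto c (𝓝[<] 1) (𝓝 y) := by
  have hq : Tendsto (fun r => c r ^ n / w) (𝓝[<] 1) (𝓝 1) := by
    simpa [hw] using h.div_const w
  obtain ⟨r₀, hr₀, hs⟩ : ∃ r₀ ∈ Ico (0 : ℝ) 1, ∀ r ∈ Ioo r₀ 1, c r ^ n / w ∈ Complex.slitPlane := by
    have h1 := hq.eventually (Complex.isOpen_slitPlane.mem_nhds Complex.one_mem_slitPlane)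
    obtain ⟨r₀, hr, hs⟩ := (mem_nhdsLT_iff_exists_mem_Ico_Ioo_subset one_pos).1 h1
    exact ⟨r₀, hr, hs⟩
  have hsub : Ioo r₀ 1 ⊆ Ioo 0 1 := Ioo_subset_Ioo_left hr₀.1
  set b : ℝ → ℂ := fun r => (c r ^ n / w) ^ ((n : ℂ)⁻¹) with hb
  have hbn (r : ℝ) : b r ^ n = c r ^ n / w := Complex.cpow_nat_inv_pow _ hn
  have hb0 : ∀ r ∈ Ioo r₀ 1, b r ≠ 0 := fun r hr h0 => by
    have := hbn r
    rw [h0, zero_pow hn] at this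
    exact Complex.slitPlane_ne_zero (hs r hr) this.symm
  have hbc : ContinuousOn b (Ioo r₀ 1) := by
    refine ContinuousOn.cpow ?_ continuousOn_const hs
    exact ((hc.mono hsub).pow n).div_const w
  have hfin : {z : ℂ | z ^ n = w}.Finite := by
    refine (Polynomial.nthRoots n w).toFinset.finite_toSet.subset fun z hz => ?_
    simpa [Polynomial.mem_nthRoots (Nat.pos_of_ne_zero hn)] using hz
  obtain ⟨y₀, hy₀⟩ := IsAlgClosed.exists_pow_nat_eq w (Nat.pos_of_ne_zero hn)
  -- Near `1` the principal root `b` of `c ^ n / w` is continuous, and `c / b` takes values in the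
  -- finite set of `n`-th roots of `w`. On an interval it is therefore constant. The root `y₀` only
  -- shows that this set is nonempty.
  obtain ⟨y, hy, hconst⟩ := isPreconnected_Ioo.eqOn_const_of_mapsTo (f := fun r => c r / b r)
    hfin.isDiscrete ((hc.mono hsub).div hbc hb0) (fun r hr => by
      have h1 : c r ^ n / w ≠ 0 := Complex.slitPlane_ne_zero (hs r hr)
      have h2 : c r ^ n ≠ 0 := fun h => h1 (by rw [h, zero_div])
      change (c r / b r) ^ n = w
      rw [div_pow, hbn]
      field_simp) ⟨y₀, hy₀⟩
  refine ⟨y, hy, ?_⟩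
  have hbl : Tendsto b (𝓝[<] 1) (𝓝 1) := by
    have := hq.cpow (tendsto_const_nhds (x := ((n : ℂ)⁻¹))) Complex.one_mem_slitPlane
    rwa [Complex.one_cpow] at this
  have h3 := hbl.const_mul y
  rw [mul_one] at h3
  refine h3.congr' ?_
  filter_upwards [Ioo_mem_nhdsLT hr₀.2] with r hr
  have h4 : c r / b r = y := hconst hr
  rw [← h4, div_mul_cancel₀ _ (hb0 r hr)]

variable {Θ : InnerFunction}

/-- The root is `exp (g / n)` with `exp g = Θ`. Its radial limits come from those of `Θ` through
`exists_tendsto_of_pow`. -/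
lemma InnerFunction.IsSingular.exists_root (hΘ : Θ.IsSingular) {n : ℕ} (hn : n ≠ 0) :
    ∃ ω : InnerFunction, ∀ z ∈ Disc, ω.toFun z ^ n = Θ.toFun z := by
  obtain ⟨g, hgd, hg⟩ := exists_exp_eq Θ.analytic hΘ.2
  set F : ℂ → ℂ := fun z => Complex.exp (g z / n) with hF
  have hFd : DifferentiableOn ℂ F Disc := (hgd.div_const _).cexp
  have hFn : ∀ z ∈ Disc, F z ^ n = Θ.toFun z := fun z hz => by
    rw [hF, ← Complex.exp_nat_mul, mul_div_cancel₀ _ (Nat.cast_ne_zero.2 hn), hg z hz]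
  refine ⟨⟨F, hFd, ⟨1, fun z hz => ?_⟩, ?_⟩, hFn⟩
  · rw [← pow_le_one_iff_of_nonneg (norm_nonneg _) hn, ← norm_pow, hFn z hz]
    exact Θ.norm_le_one ⟨z, hz⟩
  · filter_upwards [Θ.radial] with t ht
    obtain ⟨w, hw1, hw⟩ := ht
    have hw0 : w ≠ 0 := norm_ne_zero_iff.1 (hw1 ▸ one_ne_zero)
    have hm : MapsTo (fun r : ℝ => (r : ℂ) * (AddCircle.toCircle t : ℂ)) (Ioo 0 1) Disc :=
      fun r hr => mul_mem_disc hr.1.le hr.2 t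
    obtain ⟨y, hy, hlim⟩ := exists_tendsto_of_pow
      (hFd.continuousOn.comp (by fun_prop : Continuous fun r : ℝ =>
        (r : ℂ) * (AddCircle.toCircle t : ℂ)).continuousOn hm) hn hw0 (hw.congr' (by
          filter_upwards [Ioo_mem_nhdsLT one_pos] with r hr
          exact (hFn _ (hm hr)).symm))
    refine ⟨y, ?_, hlim⟩
    rw [← pow_eq_one_iff_of_nonneg (norm_nonneg _) hn, ← norm_pow, hy, hw1]

variable {ω : InnerFunction} {N : ℕ}

lemma bdry_pow (h : ∀ z ∈ Disc, ω.toFun z ^ N = Θ.toFun z) :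
    ∀ᵐ t ∂m, ω.bdry t ^ N = Θ.bdry t := by
  filter_upwards [ω.bddBoundary.lim, Θ.bddBoundary.lim] with t h1 h2
  refine tendsto_nhds_unique ((h1.pow N).congr' ?_) h2
  filter_upwards [Ioo_mem_nhdsLT one_pos] with r hr
  exact h _ (mul_mem_disc hr.1.le hr.2 t)

lemma BddBoundary.pow {F : ℂ → ℂ} {u : Circ → ℂ} (h : BddBoundary F u) (n : ℕ) :
    BddBoundary (fun z => F z ^ n) (fun t => u t ^ n) := by
  induction n with
  | zero =>
    simp only [pow_zero]
    exact BddBoundary.of_continuousOn (F := fun _ => 1) (by fun_prop) (by fun_prop)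
  | succ n ih => simpa only [pow_succ] using ih.mul h

/-- `Θ H² = ω (ω ^ N H²) ⊆ ω H²`, and orthogonal complements reverse the inclusion. -/
lemma modelSpace_le (h : ∀ z ∈ Disc, ω.toFun z ^ (N + 1) = Θ.toFun z) :
    modelSpace ω ≤ modelSpace Θ := by
  refine inf_le_inf le_rfl (Submodule.orthogonal_le ?_)
  rintro x ⟨g, hg, hx⟩
  have hb := (ω.bddBoundary.pow N)
  have hh := hb.isHardy.mul (mem_H2_iff.1 hg) (hb.memLp ∞)
  refine ⟨_, hh.toLp_mem, ?_⟩
  filter_upwards [hx, hh.memLp.coeFn_toLp, bdry_pow h] with t h1 h2 h3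
  rw [h1, h2, ← h3]
  ring

/-! ### Failure of the reproducing kernel thesis -/

/-- The symbol `conj (ω ^ N)`. -/
def conjPow (ω : InnerFunction) (N : ℕ) : L2 :=
  (memLp_conj ((ω.bddBoundary.pow N).memLp 2)).toLp _

lemma coeFn_conjPow (ω : InnerFunction) (N : ℕ) :
    conjPow ω N =ᵐ[m] fun t => conj (ω.bdry t ^ N) := MemLp.coeFn_toLp _

lemma conj_toFun_pow_smul_kernelL2_mem (h : ∀ z ∈ Disc, ω.toFun z ^ (N + 1) = Θ.toFun z)
    (l : Disc) : conj (ω.toFun l ^ N) • kernelL2 ω l ∈ modelSpace Θ :=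
  (modelSpace Θ).smul_mem _ (modelSpace_le h (kernelL2_mem ω l))

/-- With `c = ω λ`, on the circle `conj ω ^ N - conj c ^ (N + 1) ω = conj c ^ N (1 - conj c ω) +
conj (ω ^ N - c ^ N)`. After division by `1 - conj λ z` the first term is a multiple of the kernel
of `K_ω`, while the second is the conjugate of `z` times a difference quotient, which the projection
kills. -/
lemma tto_conjPow_kernelBdd (h : ∀ z ∈ Disc, ω.toFun z ^ (N + 1) = Θ.toFun z) (l : Disc) :
    tto Θ (conjPow ω N) (kernelBdd Θ l) =
      ⟨conj (ω.toFun l ^ N) • kernelL2 ω l, conj_toFun_pow_smul_kernelL2_mem h l⟩ := by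
  have hd := ((ω.bddBoundary.pow N).dslope l.2).isHardy.isAntiHardy_conj
  refine tto_apply_eq Θ (conj_toFun_pow_smul_kernelL2_mem h l) isHardy_zero hd ?_
  filter_upwards [coeFn_conjPow ω N, ((kernel_bddBoundary Θ l.2).memLp 2).coeFn_toLp,
    ((kernel_bddBoundary ω l.2).memLp 2).coeFn_toLp,
    Lp.coeFn_smul (conj (ω.toFun l ^ N)) (kernelL2 ω l), bdry_pow h,
    ω.conj_bdry_mul_bdry] with t h1 h2 h3 h4 h5 h8
  have h2' : ((kernelBdd Θ l : modelSpace Θ) : L2) t = kernelFun Θ l t := h2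
  have h3' : kernelL2 ω l t = kernelFun ω l t := h3
  have h6 : conj (fourier 1 t * ((ω.bdry t ^ N - ω.toFun l ^ N) /
      ((AddCircle.toCircle t : ℂ) - l))) = conj (ω.bdry t ^ N - ω.toFun l ^ N) *
        (1 - conj (l : ℂ) * (AddCircle.toCircle t : ℂ))⁻¹ := by
    rw [fourier_one, mul_div_left_comm, map_mul, ← conj_inv_one_sub l.2, Complex.conj_conj]
  rw [h1, h2', h4, Pi.smul_apply, h3', h6, kernelFun, kernelFun, ← h5, ← h l l.2, smul_eq_mul,
    div_eq_mul_inv, div_eq_mul_inv, Pi.zero_apply]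
  simp only [map_sub, map_pow]
  have h7 : conj (ω.bdry t) ^ N * ω.bdry t ^ N = 1 := by rw [← mul_pow, h8, one_pow]
  linear_combination (-conj (ω.toFun l) ^ (N + 1) * ω.bdry t *
    (1 - conj (l : ℂ) * (AddCircle.toCircle t : ℂ))⁻¹) * h7

/-- The geometric sum `1 + y + … + y ^ N` has `N + 1` terms, each at least `y ^ N`. -/
lemma succ_mul_pow_mul_one_sub_le {y : ℝ} (h0 : 0 ≤ y) (h1 : y ≤ 1) (N : ℕ) :
    (N + 1) * (y ^ N * (1 - y)) ≤ 1 - y ^ (N + 1) := by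
  rw [← geom_sum_mul_neg y (N + 1), ← mul_assoc]
  refine mul_le_mul_of_nonneg_right ?_ (sub_nonneg.2 h1)
  have : ∑ _i ∈ Finset.range (N + 1), y ^ N ≤ ∑ i ∈ Finset.range (N + 1), y ^ i :=
    Finset.sum_le_sum fun i hi => pow_le_pow_of_le_one h0 h1
      (Nat.lt_succ_iff.1 (Finset.mem_range.1 hi))
  simpa using this

lemma norm_tto_conjPow_sq_le (hΘ : Θ.Nonconstant)
    (h : ∀ z ∈ Disc, ω.toFun z ^ (N + 1) = Θ.toFun z) (l : Disc) :
    ‖tto Θ (conjPow ω N) (normKernel Θ l)‖ ^ 2 ≤ 1 / (N + 1) := by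
  have h1 : ‖tto Θ (conjPow ω N) (normKernel Θ l)‖ =
      Real.sqrt ((1 - ‖(l : ℂ)‖ ^ 2) / (1 - ‖Θ.toFun l‖ ^ 2)) *
        (‖ω.toFun l‖ ^ N * ‖kernelL2 ω l‖) := by
    rw [normKernel_eq_smul, map_smul, tto_conjPow_kernelBdd h, norm_smul, Complex.norm_real,
      Real.norm_of_nonneg (Real.sqrt_nonneg _), Submodule.coe_norm, norm_smul,
      RCLike.norm_conj, norm_pow]
  have h2 := one_sub_norm_sq_pos l
  have h3 : 0 < 1 - ‖Θ.toFun l‖ ^ 2 := by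
    nlinarith [hΘ.norm_lt_one l, norm_nonneg (Θ.toFun l)]
  have h4 := norm_kernelL2_sq ω l
  have h5 := succ_mul_pow_mul_one_sub_le (sq_nonneg ‖ω.toFun l‖)
    (pow_le_one₀ (norm_nonneg _) (ω.norm_le_one l)) N
  have h6 : (‖ω.toFun l‖ ^ 2) ^ (N + 1) = ‖Θ.toFun l‖ ^ 2 := by
    rw [← h l l.2, norm_pow]
    ring
  rw [h6, ← h4] at h5
  rw [h1, mul_pow, Real.sq_sqrt (div_nonneg h2.le h3.le), div_mul_eq_mul_div,
    div_le_div_iff₀ h3 (by positivity)]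
  refine le_trans (le_of_eq ?_) (h5.trans_eq (one_mul _).symm)
  ring

lemma rhoR_conjPow_le (hΘ : Θ.Nonconstant)
    (h : ∀ z ∈ Disc, ω.toFun z ^ (N + 1) = Θ.toFun z) :
    rhoR Θ (tto Θ (conjPow ω N)) ≤ ENNReal.ofReal (Real.sqrt (1 / (N + 1))) :=
  rhoR_le fun l => Real.le_sqrt_of_sq_le (norm_tto_conjPow_sq_le hΘ h l)

/-- The operator with symbol `conj (ω ^ N)` has norm at least one. -/
lemma exists_norm_tto_conjPow_eq (hΘ : Θ.Nonconstant)
    (h : ∀ z ∈ Disc, ω.toFun z ^ (N + 1) = Θ.toFun z) :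
    ∃ f : bddModel Θ, 0 < ‖(f : modelSpace Θ)‖ ∧
      ‖tto Θ (conjPow ω N) f‖ = ‖(f : modelSpace Θ)‖ := by
  have hω : ω.Nonconstant := fun ⟨c, hc⟩ =>
    hΘ ⟨c ^ (N + 1), fun z hz => by rw [← h z hz, hc z hz]⟩
  set l : Disc := ⟨0, mem_ball_self one_pos⟩
  set k := kernelL2 ω l
  have hkm := kernelL2_mem ω l
  have hkb : MemLp k ∞ m := (kernelBdd ω l).2
  have hk0 : 0 < ‖k‖ := norm_pos_iff.2 fun h0 => hω.kernelBdd_ne_zero l (Subtype.ext h0)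
  have hb := ω.bddBoundary.pow N
  -- The test vector is `ω ^ N k` with `k` the kernel of `K_ω` at `0`. It lies in `K_Θ` because
  -- `conj Θ ω ^ N k = conj ω k`, and the symbol sends it to `k`, which has the same norm as `|ω| =
  -- 1` almost everywhere.
  have hf := hb.isHardy.mul (isHardy_of_mem hkm) (hb.memLp ∞)
  have hfm := toLp_mem_modelSpace Θ hf ((isAntiHardy_of_mem hkm).congr (by
    filter_upwards [bdry_pow h, ω.conj_bdry_mul_bdry] with t h1 h2
    rw [← h1, pow_succ, map_mul, map_pow]
    have h3 : conj (ω.bdry t) ^ N * ω.bdry t ^ N = 1 := by rw [← mul_pow, h2, one_pow]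
    linear_combination (-conj (ω.bdry t) * k t) * h3))
  have hfb : MemLp (hf.memLp.toLp _) ∞ m :=
    (memLp_congr_ae hf.memLp.coeFn_toLp).2 (MemLp.mul' (p := ∞) (q := ∞) (r := ∞) hkb (hb.memLp ∞))
  have hnorm : ‖hf.memLp.toLp _‖ = ‖k‖ := by
    rw [Lp.norm_toLp, Lp.norm_def]
    congr 1
    refine eLpNorm_congr_norm_ae ?_
    filter_upwards [ω.norm_bdry] with t h1
    rw [norm_mul, norm_pow, h1, one_pow, one_mul]
  have hT : tto Θ (conjPow ω N) ⟨⟨_, hfm⟩, hfb⟩ = ⟨k, modelSpace_le h hkm⟩ := by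
    refine tto_apply_eq Θ _ isHardy_zero isAntiHardy_zero ?_
    filter_upwards [coeFn_conjPow ω N, hf.memLp.coeFn_toLp, ω.conj_bdry_mul_bdry] with t h1 h2 h3
    rw [h1, h2, map_pow, Pi.zero_apply]
    have h4 : conj (ω.bdry t) ^ N * ω.bdry t ^ N = 1 := by rw [← mul_pow, h3, one_pow]
    linear_combination k t * h4
  refine ⟨⟨⟨_, hfm⟩, hfb⟩, ?_, ?_⟩
  · exact hnorm ▸ hk0
  · rw [hT]
    exact hnorm.symm

/-- The reproducing kernel thesis fails for singular inner functions. -/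
theorem InnerFunction.IsSingular.exists_not_isBddOp (hΘ : Θ.IsSingular) :
    ∃ φ : L2, rhoR Θ (tto Θ φ) < ∞ ∧ ¬ IsBddOp Θ (tto Θ φ) := by
  by_contra! H
  obtain ⟨M, hM0, hM⟩ := exists_uniform_bound hΘ.1 H
  -- The uniform bound will force `1 ≤ M / √(N + 1)`, that is `N + 1 ≤ M²`.
  obtain ⟨N, hN⟩ := exists_nat_gt (M ^ 2)
  obtain ⟨ω, hω⟩ := hΘ.exists_root N.succ_ne_zero
  obtain ⟨f, hf0, hf⟩ := exists_norm_tto_conjPow_eq hΘ.1 hω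
  have h1 := rhoR_conjPow_le hΘ.1 hω
  have h2 := hM (conjPow ω N) (h1.trans_lt ENNReal.ofReal_lt_top) f
  rw [hf] at h2
  have h3 := le_of_mul_le_mul_right ((one_mul _).trans_le h2) hf0
  have h4 : (rhoR Θ (tto Θ (conjPow ω N))).toReal ≤ Real.sqrt (1 / (N + 1)) :=
    ENNReal.toReal_le_of_le_ofReal (Real.sqrt_nonneg _) h1
  have h5 : 1 ≤ M * Real.sqrt (1 / (N + 1)) := h3.trans (by gcongr)
  have h6 : (1 : ℝ) ≤ (M * Real.sqrt (1 / (N + 1))) ^ 2 := one_le_pow₀ h5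
  rw [mul_pow, Real.sq_sqrt (by positivity), mul_one_div, le_div_iff₀ (by positivity)] at h6
  linarith

end TruncToep

end

theorem mainTheorem9 (Θ : TruncToep.InnerFunction) (hΘ : Θ.Nonconstant) :
    ((∀ φ : TruncToep.L2, TruncToep.rhoR Θ (TruncToep.tto Θ φ) < ∞ →
        TruncToep.IsBddOp Θ (TruncToep.tto Θ φ)) →
      -- every sequence that is Cauchy for `ρ_r` converges for `ρ_r`
      (∀ A : ℕ → TruncToep.bddTTO Θ,
        (∀ ε : ℝ≥0∞, 0 < ε → ∃ N : ℕ, ∀ i ≥ N, ∀ j ≥ N, TruncToep.rhoT Θ (A i - A j) < ε) →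
        ∃ B : TruncToep.bddTTO Θ,
          Tendsto (fun n => TruncToep.rhoT Θ (A n - B)) atTop (𝓝 0)) ∧
      -- `ρ_r` is equivalent to the operator norm
      (∃ M : ℝ, 0 < M ∧ ∀ A : TruncToep.bddTTO Θ,
        TruncToep.rhoT Θ A ≤ ‖A‖ₑ ∧ ‖A‖ₑ ≤ ENNReal.ofReal M * TruncToep.rhoT Θ A)) ∧
    -- failure of the reproducing kernel thesis for singular inner functions
    (Θ.IsSingular → ∃ φ : TruncToep.L2, TruncToep.rhoR Θ (TruncToep.tto Θ φ) < ∞ ∧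
      ¬ TruncToep.IsBddOp Θ (TruncToep.tto Θ φ)) :=
  ⟨fun H => ⟨TruncToep.exists_tendsto_rhoT hΘ H, TruncToep.exists_enorm_le hΘ H⟩,
    fun hs => hs.exists_not_isBddOp⟩
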